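/- For $f,g\in\mathcal S^{(1)}(\mathbb R^d)$ put $$R_g f(x,\omega)=\int_{\mathbb R^d} e^{4\pi i\,\omega\cdot(t-x)}\,f(2x-t)\,\overline{g(t)}\,dt ,\qquad x,\omega\in\mathbb R^d ,$$ and $\check g(t)=g(-t)$. Here $\mathcal S^{(1)}(\mathbb R^n)$ is the Gelfand–Shilov space of all $f\in C^\infty(\mathbb R^n)$ such that for all $A,B>0$ there is a $C>0$ with $\|x^\alpha\partial^\beta f\|_{L^\infty}\le C A^{|\alpha|}|\alpha|!\,B^{|\beta|}|\beta|!$ for all multi-indices $\alpha,\beta$, with its projective limit topology; $\mathcal S^{(1)\prime}(\mathbb R^n)$ is its dual space, with the strong topology; and $\langle u,g\rangle=u(\overline g)$ is the pairing extending the inner product of $L^2$. For $a\in\mathcal S^{(1)\prime}(\mathbb R^{2d})$ and $\varphi_1,\varphi_2\in\mathcal S^{(1)}(\mathbb R^d)$, the localization operator $A_a^{\varphi_1,\varphi_2}:\mathcal S^{(1)}(\mathbb R^d)\to\mathcal S^{(1)\prime}(\mathbb R^d)$ is given by $$\langle A_a^{\varphi_1,\varphi_2}f,g\rangle=\Big\langle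 a\cdot R_{\check\varphi_1}f\big(\tfrac{\cdot}{2}\big),\,R_{\check\varphi_2}g\big(\tfrac{\cdot}{2}\big)\Big\rangle ,\qquad f,g\in\mathcal S^{(1)}(\mathbb R^d).$$ For $\sigma\in\mathcal S^{(1)\prime}(\mathbb R^{2d})$, $L_\sigma:\mathcal S^{(1)}(\mathbb R^d)\to\mathcal S^{(1)\prime}(\mathbb R^d)$ denotes the Weyl pseudodifferential operator with Weyl symbol $\sigma$, that is, the extension by duality from $\sigma\in\mathcal S^{(1)}(\mathbb R^{2d})$ of $$L_\sigma f(x)=\iint \sigma\big(\tfrac{x+y}{2},\omega\big)f(y)\,e^{2\pi i(x-y)\cdot\omega}\,dy\,d\omega .$$ For $\psi\in\mathcal S^{(1)}(\mathbb R^{2d})$, the convolution $a*\psi\in\mathcal S^{(1)\prime}(\mathbb R^{2d})$ is given by $(a*\psi)(G)=a(\check\psi*G)$ for $G\in\mathcal S^{(1)}(\mathbb R^{2d})$. Lemma. Let $a\in\mathcal S^{(1)\prime}(\mathbb R^{2d})$ and $\varphi_1,\varphi_2\in\mathcal S^{(1)}(\mathbb R^d)$. Then $R_{\varphi_1}\varphi_2\in\mathcal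 S^{(1)}(\mathbb R^{2d})$, all these objects are well defined, the operators are continuous, and the localization operator $A_a^{\varphi_1,\varphi_2}$ is the Weyl pseudodifferential operator with Weyl symbol $\sigma=2^{d}\,a*R_{\varphi_1}\varphi_2$; in other words, $$A_a^{\varphi_1,\varphi_2}=2^{d}\,L_{a*R_{\varphi_1}\varphi_2}.$$ -/

import Mathlib

open MeasureTheory
open scoped Nat ContDiff ComplexConjugate RealInnerProductSpace

noncomputable section

/-! The Gelfand-Shilov space `S^(1)` (Beurling type, Gevrey index one) -/

/-- The smooth functions `f : E → ℂ` such that for all `A, B > 0` there is a `C` with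
`|x|^k |D^n f(x)| ≤ C A^k k! B^n n!` for all `k`, `n`, `x`.  As `A` and `B` are arbitrary, on a finite
dimensional `E` this is the same, for every choice of norm and coordinates, as the bounds
`|x^α ∂^β f(x)| ≤ C A^|α| |α|! B^|β| |β|!` for all multi-indices: dimensional factors `c^k`, `c^n`
are absorbed by `A` and `B`. -/
def gelfandShilovSubmodule (E : Type*) [NormedAddCommGroup E] [NormedSpace ℝ E] :
    Submodule ℂ (E → ℂ) where
  carrier := {f | ContDiff ℝ ∞ f ∧ ∀ A B : ℝ, 0 < A → 0 < B → ∃ C : ℝ, ∀ (k n : ℕ) (x : E),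
    ‖x‖ ^ k * ‖iteratedFDeriv ℝ n f x‖ ≤ C * ((A ^ k * k !) * (B ^ n * n !))}
  add_mem' := by
    rintro f g ⟨hf, hf'⟩ ⟨hg, hg'⟩
    refine ⟨hf.add hg, fun A B hA hB => ?_⟩
    obtain ⟨C, hC⟩ := hf' A B hA hB
    obtain ⟨D, hD⟩ := hg' A B hA hB
    refine ⟨C + D, fun k n x => ?_⟩
    rw [iteratedFDeriv_add_apply ((hf.of_le (mod_cast le_top)).contDiffAt)
      ((hg.of_le (mod_cast le_top)).contDiffAt), add_mul]
    refine le_trans ?_ (add_le_add (hC k n x) (hD k n x))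
    rw [← mul_add]
    gcongr
    exact norm_add_le _ _
  zero_mem' := ⟨contDiff_const, fun A B _ _ => ⟨0, fun k n x => by
    have h : (0 : E → ℂ) = fun _ => 0 := rfl
    simp [h]⟩⟩
  smul_mem' := by
    rintro c f ⟨hf, hf'⟩
    refine ⟨contDiff_const.smul hf, fun A B hA hB => ?_⟩
    obtain ⟨C, hC⟩ := hf' A B hA hB
    refine ⟨‖c‖ * C, fun k n x => ?_⟩
    rw [iteratedFDeriv_const_smul_apply ((hf.of_le (mod_cast le_top)).contDiffAt), norm_smul,
      mul_left_comm, mul_assoc ‖c‖]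
    exact mul_le_mul_of_nonneg_left (hC k n x) (norm_nonneg c)

/-- The Gelfand-Shilov space `S^(1)(E)`. -/
def GelfandShilov (E : Type*) [NormedAddCommGroup E] [NormedSpace ℝ E] : Type _ :=
  gelfandShilovSubmodule E

namespace GelfandShilov

variable {E : Type*} [NormedAddCommGroup E] [NormedSpace ℝ E]

instance : AddCommGroup (GelfandShilov E) := inferInstanceAs (AddCommGroup (gelfandShilovSubmodule E))

instance : Module ℂ (GelfandShilov E) := inferInstanceAs (Module ℂ (gelfandShilovSubmodule E))

instance : FunLike (GelfandShilov E) E ℂ where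
  coe f := f.1
  coe_injective := Subtype.val_injective

@[ext] theorem ext {f g : GelfandShilov E} (h : ∀ x, f x = g x) : f = g := DFunLike.ext _ _ h

@[simp] theorem add_apply (f g : GelfandShilov E) (x : E) : (f + g) x = f x + g x := rfl

@[simp] theorem smul_apply (c : ℂ) (f : GelfandShilov E) (x : E) : (c • f) x = c * f x := rfl

theorem coe_add (f g : GelfandShilov E) : ⇑(f + g) = ⇑f + ⇑g := rfl

theorem coe_smul (c : ℂ) (f : GelfandShilov E) : ⇑(c • f) = c • ⇑f := rfl

theorem contDiff (f : GelfandShilov E) : ContDiff ℝ ∞ f := f.2.1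

/-- The quotients whose supremum is the seminorm of `f` with parameters `A`, `B`. -/
def quot (A B : ℝ) (f : GelfandShilov E) (q : ℕ × ℕ × E) : ℝ :=
  ‖q.2.2‖ ^ q.1 * ‖iteratedFDeriv ℝ q.2.1 f q.2.2‖ / ((A ^ q.1 * q.1 !) * (B ^ q.2.1 * q.2.1 !))

theorem bddAbove_quot {A B : ℝ} (hA : 0 < A) (hB : 0 < B) (f : GelfandShilov E) :
    BddAbove (Set.range (quot A B f)) := by
  obtain ⟨C, hC⟩ := f.2.2 A B hA hB
  refine ⟨C, ?_⟩
  rintro _ ⟨⟨k, n, x⟩, rfl⟩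
  unfold quot
  rw [div_le_iff₀ (by positivity)]
  exact hC k n x

/-- The seminorm `sup |x|^k |D^n f(x)| / (A^k k! B^n n!)` over all `k`, `n`, `x`. -/
def seminorm (A B : ℝ) (hA : 0 < A) (hB : 0 < B) : Seminorm ℂ (GelfandShilov E) :=
  Seminorm.of (fun f => ⨆ q, quot A B f q)
    (fun f g => by
      refine ciSup_le fun q => le_trans ?_
        (add_le_add (le_ciSup (bddAbove_quot hA hB f) q) (le_ciSup (bddAbove_quot hA hB g) q))
      unfold quot
      rw [← add_div, ← mul_add, coe_add, iteratedFDeriv_add_apply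
        ((f.contDiff.of_le (mod_cast le_top)).contDiffAt)
        ((g.contDiff.of_le (mod_cast le_top)).contDiffAt)]
      gcongr
      exact norm_add_le _ _)
    (fun c f => by
      rw [Real.mul_iSup_of_nonneg (norm_nonneg c)]
      congr 1
      ext q
      unfold quot
      rw [coe_smul, iteratedFDeriv_const_smul_apply
        ((f.contDiff.of_le (mod_cast le_top)).contDiffAt), norm_smul]
      ring)

/-- The seminorms of `S^(1)(E)`, indexed by the pairs of positive numbers `A`, `B`. -/
def seminormFamily (E : Type*) [NormedAddCommGroup E] [NormedSpace ℝ E] :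
    SeminormFamily ℂ (GelfandShilov E) (Set.Ioi (0 : ℝ) × Set.Ioi (0 : ℝ)) :=
  fun r => seminorm r.1 r.2 r.1.2 r.2.2

/-- The projective limit topology of `S^(1)(E)`. -/
instance : TopologicalSpace (GelfandShilov E) := (seminormFamily E).moduleFilterBasis.topology

theorem withSeminorms : WithSeminorms (seminormFamily E) := ⟨rfl⟩

instance : IsTopologicalAddGroup (GelfandShilov E) := withSeminorms.topologicalAddGroup

instance : ContinuousSMul ℂ (GelfandShilov E) := withSeminorms.continuousSMul

/-- The complex conjugate of a function in `S^(1)(E)`. -/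
def conjugate (f : GelfandShilov E) : GelfandShilov E :=
  ⟨fun x => conj (f x), Complex.conjCLE.contDiff.comp f.contDiff, fun A B hA hB => by
    obtain ⟨C, hC⟩ := f.2.2 A B hA hB
    refine ⟨C, fun k n x => ?_⟩
    have h := Complex.conjLIE.norm_iteratedFDeriv_comp_left (𝕜 := ℝ) f x n
    exact (congrArg (fun r => ‖x‖ ^ k * r) h).le.trans (hC k n x)⟩

@[simp] theorem conjugate_apply (f : GelfandShilov E) (x : E) : f.conjugate x = conj (f x) := rfl

@[simp] theorem conjugate_conjugate (f : GelfandShilov E) : f.conjugate.conjugate = f := by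
  ext x; simp

end GelfandShilov

/-- The ultradistributions `S^(1)'(E)`: continuous linear functionals on `S^(1)(E)`, with the strong
dual topology.  The sesquilinear pairing extending the inner product of `L²` is
`⟨u, g⟩ = u (conj g)`. -/
abbrev Ultradistribution (E : Type*) [NormedAddCommGroup E] [NormedSpace ℝ E] : Type _ :=
  GelfandShilov E →L[ℂ] ℂ

/-- `ℝ^d` with the Euclidean norm; `ℝ^{2d}` is `Rd d × Rd d`, with points `(x, ω)`. -/
abbrev Rd (d : ℕ) : Type := EuclideanSpace ℝ (Fin d)

variable {d : ℕ}

/-- The Grossmann-Royer transform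
`R_g f (x, ω) = ∫ exp(4πi ω·(t - x)) f(2x - t) conj(g(t)) dt`. -/
def grossmannRoyer (g f : Rd d → ℂ) (z : Rd d × Rd d) : ℂ :=
  ∫ t : Rd d, Complex.exp (4 * Real.pi * Complex.I * (⟪z.2, t - z.1⟫ : ℝ)) *
    f ((2 : ℝ) • z.1 - t) * conj (g t)

/-- `σ` is the convolution `a * ψ` of the ultradistribution `a` and the test function `ψ`, that is,
`σ(G) = a(ψˇ * G)` for all test functions `G`, where `(ψˇ * G)(z) = ∫ ψ(w - z) G(w) dw`
is again a test function. -/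
def IsConvolution (a : Ultradistribution (Rd d × Rd d)) (ψ : GelfandShilov (Rd d × Rd d))
    (σ : Ultradistribution (Rd d × Rd d)) : Prop :=
  ∀ G : GelfandShilov (Rd d × Rd d), ∃ H : GelfandShilov (Rd d × Rd d),
    (∀ z, H z = ∫ w, ψ (w - z) * G w) ∧ σ G = a H

/-- `T` is the localization operator `A_a^{φ₁, φ₂}` with symbol `a` and windows `φ₁`, `φ₂`:
`⟨T f, g⟩ = ⟨a · R_{φ₁ˇ} f(·/2), R_{φ₂ˇ} g(·/2)⟩` for all `f`, `g` in `S^(1)(ℝ^d)`, where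
`φˇ(t) = φ(-t)`; the function to which `a` is applied is a test function. -/
def IsLocalizationOperator (a : Ultradistribution (Rd d × Rd d)) (φ₁ φ₂ : GelfandShilov (Rd d))
    (T : GelfandShilov (Rd d) →L[ℂ] Ultradistribution (Rd d)) : Prop :=
  ∀ f g : GelfandShilov (Rd d), ∃ F : GelfandShilov (Rd d × Rd d),
    (∀ z, F z = grossmannRoyer (fun t => φ₁ (-t)) f ((2⁻¹ : ℝ) • z) *
      conj (grossmannRoyer (fun t => φ₂ (-t)) g ((2⁻¹ : ℝ) • z))) ∧
    T f g.conjugate = a F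

/-- The Weyl pseudodifferential operator with a symbol `τ` in `S^(1)(ℝ^{2d})`:
`L_τ f(x) = ∬ τ((x + y)/2, ω) f(y) exp(2πi (x - y)·ω) dy dω`. -/
def weylTestOperator (τ : GelfandShilov (Rd d × Rd d)) (f : GelfandShilov (Rd d)) (x : Rd d) : ℂ :=
  ∫ p : Rd d × Rd d, τ ((2⁻¹ : ℝ) • (x + p.1), p.2) * f p.1 *
    Complex.exp (2 * Real.pi * Complex.I * (⟪x - p.1, p.2⟫ : ℝ))

/-- The test function `K` represents the functional `τ ↦ ⟨L_τ f, g⟩` on test symbols. -/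
def RepresentsWeylForm (f g : GelfandShilov (Rd d)) (K : GelfandShilov (Rd d × Rd d)) : Prop :=
  ∀ τ : GelfandShilov (Rd d × Rd d),
    ∫ x, weylTestOperator τ f x * conj (g x) = ∫ z, τ z * K z

/-- `T` is the Weyl pseudodifferential operator `L_σ` with Weyl symbol `σ` in `S^(1)'(ℝ^{2d})`.
This is the extension by duality of `weylTestOperator` from test symbols to ultradistributions:
for all `f`, `g` the functional `τ ↦ ⟨L_τ f, g⟩` is integration against a test function
`K` (unique, see `RepresentsWeylForm.unique`), and `⟨L_σ f, g⟩ = σ(K)`. -/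
def IsWeylOperator (σ : Ultradistribution (Rd d × Rd d))
    (T : GelfandShilov (Rd d) →L[ℂ] Ultradistribution (Rd d)) : Prop :=
  ∀ f g : GelfandShilov (Rd d), ∃ K : GelfandShilov (Rd d × Rd d),
    RepresentsWeylForm f g K ∧ T f g.conjugate = σ K

/-! The objects just described are unique. -/

theorem IsConvolution.unique {a σ σ' : Ultradistribution (Rd d × Rd d)}
    {ψ : GelfandShilov (Rd d × Rd d)} (h : IsConvolution a ψ σ) (h' : IsConvolution a ψ σ') :
    σ = σ' := by
  ext G
  obtain ⟨H, hH, e⟩ := h G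
  obtain ⟨H', hH', e'⟩ := h' G
  rw [e, e', show H = H' from GelfandShilov.ext fun z => (hH z).trans (hH' z).symm]

theorem IsLocalizationOperator.unique {a : Ultradistribution (Rd d × Rd d)}
    {φ₁ φ₂ : GelfandShilov (Rd d)} {T T' : GelfandShilov (Rd d) →L[ℂ] Ultradistribution (Rd d)}
    (h : IsLocalizationOperator a φ₁ φ₂ T) (h' : IsLocalizationOperator a φ₁ φ₂ T') : T = T' := by
  ext f g
  obtain ⟨F, hF, e⟩ := h f g.conjugate
  obtain ⟨F', hF', e'⟩ := h' f g.conjugate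
  rw [GelfandShilov.conjugate_conjugate] at e e'
  rw [e, e', show F = F' from GelfandShilov.ext fun z => (hF z).trans (hF' z).symm]

/-- A function in `S^(1)(E)` is a Schwartz function. -/
def GelfandShilov.toSchwartz {E : Type*} [NormedAddCommGroup E] [NormedSpace ℝ E]
    (f : GelfandShilov E) : SchwartzMap E ℂ where
  toFun := f
  smooth' := f.contDiff
  decay' := fun k n => by
    obtain ⟨C, hC⟩ := f.2.2 1 1 one_pos one_pos
    exact ⟨_, fun x => hC k n x⟩

theorem GelfandShilov.integrable_mul {E : Type*} [NormedAddCommGroup E] [NormedSpace ℝ E]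
    [MeasureSpace E] [BorelSpace E] [SecondCountableTopology E]
    [(volume : Measure E).HasTemperateGrowth] (f g : GelfandShilov E) :
    Integrable (fun x => f x * g x) := by
  have hf : Integrable (f : E → ℂ) := f.toSchwartz.integrable
  obtain ⟨C, hC⟩ := g.2.2 1 1 one_pos one_pos
  refine hf.mul_bdd (c := C) g.contDiff.continuous.aestronglyMeasurable 
    (Filter.Eventually.of_forall fun x => ?_)
  have h : ‖x‖ ^ 0 * ‖iteratedFDeriv ℝ 0 (⇑g) x‖ ≤ _ := hC 0 0 x
  simpa using h

instance : (volume : Measure (Rd d × Rd d)).IsAddHaarMeasure :=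
  inferInstanceAs (((volume : Measure (Rd d)).prod (volume : Measure (Rd d))).IsAddHaarMeasure)

theorem RepresentsWeylForm.unique {f g : GelfandShilov (Rd d)}
    {K K' : GelfandShilov (Rd d × Rd d)} (h : RepresentsWeylForm f g K)
    (h' : RepresentsWeylForm f g K') : K = K' := by
  set D : GelfandShilov (Rd d × Rd d) := K + (-1 : ℂ) • K' with hD
  have h0 : ∫ z, D.conjugate z * D z = 0 := by
    have e := (h D.conjugate).symm.trans (h' D.conjugate)
    rw [← sub_eq_zero, ← integral_sub (D.conjugate.integrable_mul K)
      (D.conjugate.integrable_mul K')] at e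
    rw [← e]
    congr 1
    ext z
    rw [hD, GelfandShilov.add_apply, GelfandShilov.smul_apply]
    ring
  have h1 : ∫ z, ‖D z‖ ^ 2 = 0 := by
    have e : ∀ z, D.conjugate z * D z = ((‖D z‖ ^ 2 : ℝ) : ℂ) := fun z => by
      rw [GelfandShilov.conjugate_apply, Complex.conj_mul']; push_cast; rfl
    simp_rw [e] at h0
    rw [integral_complex_ofReal] at h0
    exact_mod_cast h0
  have hint : Integrable (fun z => ‖D z‖ ^ 2) := by
    refine (D.conjugate.integrable_mul D).norm.congr (Filter.Eventually.of_forall fun z => ?_)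
    simp [sq]
  have hcont : Continuous fun z => ‖D z‖ ^ 2 := (D.contDiff.continuous.norm.pow 2)
  have h2 := (integral_eq_zero_iff_of_nonneg (fun z => by positivity) hint).1 h1
  have h3 := (hcont.ae_eq_iff_eq volume continuous_const).1 h2
  ext z
  have h4 : ‖D z‖ ^ 2 = 0 := congrFun h3 z
  have h5 : D z = 0 := by simpa using h4
  rw [hD, GelfandShilov.add_apply, GelfandShilov.smul_apply] at h5
  linear_combination h5

theorem IsWeylOperator.unique {σ : Ultradistribution (Rd d × Rd d)}
    {T T' : GelfandShilov (Rd d) →L[ℂ] Ultradistribution (Rd d)}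
    (h : IsWeylOperator σ T) (h' : IsWeylOperator σ T') : T = T' := by
  ext f g
  obtain ⟨K, hK, e⟩ := h f g.conjugate
  obtain ⟨K', hK', e'⟩ := h' f g.conjugate
  rw [GelfandShilov.conjugate_conjugate] at e e'
  rw [e, e', hK.unique hK']

end

/-!
The space `S^(1)` is stable under three operations, each with quantitative bounds: tensor products,
composition with injective linear maps, and partial Fourier integrals
`Φ ↦ (y ↦ ∫ exp(i b(s, y)) Φ(π y, s) ds)`. Both the transform `(f, g) ↦ R_g f` and the convolution
`G ↦ ψˇ * G` are composed of these, so they map test functions to test functions continuously.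

The bounds are tracked by `GevreyBound`. A derivative of a partial Fourier integral is the integral of
an amplitude obtained by one differentiation plus one multiplication by a linear form, and a power of
the frequency is traded, by parts, for a differentiation. If the total number of such operations is
measured by one factorial, each operation raises its argument by one; the commutators cost only a
factor `1 + q / (a + 1)` at step `a`, and the product of these factors grows at most geometrically
(`exists_prod_one_add_div_le`). Since the scale `h` is arbitrary, geometric losses are harmless, and
`exists_gevreyBound_oscillatoryIntegral` follows.

A continuous functional `u` on test functions of two variables gives a continuous operator
`f ↦ (g ↦ u (f ⊗ g))` into the strong dual (`kernelOperator`), because `u` is bounded by a single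
seminorm and that seminorm of `f ⊗ g` by a product of seminorms. The Weyl operator `L_σ` arises in this
way, as `⟨L_τ f, g⟩ = ∫ τ · 2^d R_g f` by the change of variables `(q, s) ↦ (q - s, q + s)`
(`representsWeylForm_grossmannRoyer`).

The relation between the two operators is Moyal's identity: with `ρ = R_{φ₁} φ₂`, Parseval's formula
in the frequency and the same change of variables give
`2^d · (ρˇ * 2^d R_g f)(z) = R_{φ₁ˇ} f(z/2) · conj (R_{φ₂ˇ} g(z/2))`
(`localization_symbol_eq`). Applying `a` to both sides yields `A = 2^d L`, and the left-hand side also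
shows that the function to which `a` is applied is a test function.
-/

noncomputable section

/-! ### Bounds defining `S^(1)` -/

theorem factorial_add_le (m n : ℕ) : (m + n)! ≤ 2 ^ (m + n) * (m ! * n !) := by
  rw [← Nat.add_choose_mul_factorial_mul_factorial, mul_assoc]
  exact Nat.mul_le_mul_right _ (Nat.choose_le_two_pow _ _)

section GevreyBound

variable {E F : Type*} [NormedAddCommGroup E] [NormedSpace ℝ E] [NormedAddCommGroup F]
  [NormedSpace ℝ F]

/-- Quantitative membership in `S^(1)`: both indices are measured by a single scale `h` and a single
factorial, and `a` counts the differentiations and multiplications by linear forms already performed.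
Up to a change of `h` by a factor two, `a = 0` gives the seminorms of `S^(1)`. -/
structure GevreyBound (h : ℝ) (a : ℕ) (C : ℝ) (f : E → ℂ) : Prop where
  contDiff : ContDiff ℝ ∞ f
  bound : ∀ (m j : ℕ) (x : E),
    ‖x‖ ^ m * ‖iteratedFDeriv ℝ j f x‖ ≤ C * (h ^ (m + j) * (m + j + a)!)

namespace GevreyBound

variable {h : ℝ} {a : ℕ} {C D : ℝ} {f g : E → ℂ}

theorem nonneg (hf : GevreyBound h a C f) : 0 ≤ C := by
  have h1 := hf.bound 0 0 0
  simp only [pow_zero, one_mul, add_zero, zero_add] at h1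
  have h2 : (0 : ℝ) < a ! := by positivity
  exact nonneg_of_mul_nonneg_left ((norm_nonneg _).trans h1) h2

theorem add (hf : GevreyBound h a C f) (hg : GevreyBound h a D g) :
    GevreyBound h a (C + D) (fun x => f x + g x) := by
  refine ⟨hf.contDiff.add hg.contDiff, fun m j x => ?_⟩
  have e : (fun x => f x + g x) = f + g := rfl
  rw [e, iteratedFDeriv_add_apply ((hf.contDiff.of_le (mod_cast le_top)).contDiffAt)
      ((hg.contDiff.of_le (mod_cast le_top)).contDiffAt), add_mul]
  refine le_trans ?_ (add_le_add (hf.bound m j x) (hg.bound m j x))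
  rw [← mul_add]
  gcongr
  exact norm_add_le _ _

theorem const_mul (hf : GevreyBound h a C f) (c : ℂ) :
    GevreyBound h a (‖c‖ * C) (fun x => c * f x) := by
  refine ⟨contDiff_const.mul hf.contDiff, fun m j x => ?_⟩
  have e : (fun x => c * f x) = c • f := rfl
  rw [e, iteratedFDeriv_const_smul_apply ((hf.contDiff.of_le (mod_cast le_top)).contDiffAt),
    norm_smul, mul_left_comm, mul_assoc ‖c‖]
  exact mul_le_mul_of_nonneg_left (hf.bound m j x) (norm_nonneg c)

theorem norm_pow_mul_le (hf : GevreyBound h a C f) (m : ℕ) (x : E) :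
    ‖x‖ ^ m * ‖f x‖ ≤ C * (h ^ m * (m + a)!) := by
  simpa using hf.bound m 0 x

/-- The bound for a directional derivative costs one factorial and a factor `h`. -/
theorem fderiv_apply (hf : GevreyBound h a C f) {v : E} {r : ℝ} (hv : ‖v‖ ≤ r) :
    GevreyBound h (a + 1) (r * (C * h)) (fun x => fderiv ℝ f x v) := by
  have hC := hf.nonneg
  have hd : ContDiff ℝ ∞ (fderiv ℝ f) := hf.contDiff.fderiv_right (by simp)
  refine ⟨hd.clm_apply contDiff_const, fun m j x => ?_⟩
  have h1 : ‖iteratedFDeriv ℝ j (fun x => fderiv ℝ f x v) x‖ ≤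
      ‖v‖ * ‖iteratedFDeriv ℝ (j + 1) f x‖ := by
    rw [← norm_iteratedFDeriv_fderiv]
    exact norm_iteratedFDeriv_clm_apply_const (N := j)
      ((hd.of_le (mod_cast le_top)).contDiffAt) le_rfl
  calc ‖x‖ ^ m * ‖iteratedFDeriv ℝ j (fun x => fderiv ℝ f x v) x‖
      ≤ ‖x‖ ^ m * (r * ‖iteratedFDeriv ℝ (j + 1) f x‖) := by
        gcongr
        exact h1.trans (by gcongr)
    _ = r * (‖x‖ ^ m * ‖iteratedFDeriv ℝ (j + 1) f x‖) := by ring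
    _ ≤ r * (C * (h ^ (m + (j + 1)) * (m + (j + 1) + a)!)) := by
        have : 0 ≤ r := (norm_nonneg v).trans hv
        exact mul_le_mul_of_nonneg_left (hf.bound m (j + 1) x) this
    _ = r * (C * h) * (h ^ (m + j) * (m + j + (a + 1))!) := by
        rw [show m + (j + 1) + a = m + j + (a + 1) by ring]; ring

/-- Multiplication by a linear form of norm at most `r`. The commutator with the derivatives
contributes the term `1 / (h (a + 1))`, whose decay in `a` is what keeps iterated products under
control. -/
theorem clm_mul (hf : GevreyBound h a C f) (l : E →L[ℝ] ℂ) {r : ℝ} (hl : ‖l‖ ≤ r) (hh : 0 < h) :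
    GevreyBound h (a + 1) (r * (C * (h + 1 / (h * (a + 1))))) (fun x => l x * f x) := by
  have hC := hf.nonneg
  have hr : 0 ≤ r := (norm_nonneg l).trans hl
  refine ⟨l.contDiff.mul hf.contDiff, fun m j x => ?_⟩
  have hl0 : ‖iteratedFDeriv ℝ 0 l x‖ ≤ r * ‖x‖ := by
    rw [norm_iteratedFDeriv_zero]
    exact (l.le_opNorm x).trans (by gcongr)
  have hl1 : ‖iteratedFDeriv ℝ 1 l x‖ ≤ r := by
    rw [norm_iteratedFDeriv_one, l.fderiv]
    exact hl
  have hl2 : ∀ i, ‖iteratedFDeriv ℝ (i + 2) l x‖ = 0 := fun i => by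
    have e : fderiv ℝ l = fun _ => l := by
      ext1 y
      exact l.fderiv
    rw [← norm_iteratedFDeriv_fderiv, e, iteratedFDeriv_const_of_ne (by simp)]
    simp
  have leib := norm_iteratedFDeriv_mul_le (N := j) (l.contDiff (n := j))
    (hf.contDiff.of_le (mod_cast le_top)) x (n := j) le_rfl
  have h1 : ‖iteratedFDeriv ℝ j (fun x => l x * f x) x‖ ≤
      r * ‖x‖ * ‖iteratedFDeriv ℝ j f x‖ + j * (r * ‖iteratedFDeriv ℝ (j - 1) f x‖) := by
    refine leib.trans ?_
    rcases j with _ | j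
    · simp only [zero_add, Finset.sum_range_one, Nat.choose_self, Nat.cast_one, one_mul,
        Nat.cast_zero, zero_mul, add_zero]
      gcongr
    · rw [Finset.sum_range_succ', Finset.sum_range_succ',
        Finset.sum_eq_zero fun i _ => by rw [hl2 i]; simp, zero_add, add_comm]
      simp only [Nat.choose_zero_right, Nat.cast_one, one_mul, zero_add, Nat.choose_one_right,
        Nat.sub_zero, mul_assoc]
      refine add_le_add ?_ (by gcongr)
      simpa [mul_assoc] using mul_le_mul_of_nonneg_right hl0
        (norm_nonneg (iteratedFDeriv ℝ (j + 1) f x))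
  have key : ‖x‖ ^ m * (j * ‖iteratedFDeriv ℝ (j - 1) f x‖) ≤
      C * (1 / (h * (a + 1))) * (h ^ (m + j) * (m + j + (a + 1))!) := by
    rcases j with _ | j
    · simp; positivity
    · have b := hf.bound m j x
      rw [show m + (j + 1) + (a + 1) = m + j + a + 1 + 1 by ring, Nat.factorial_succ,
        Nat.factorial_succ, Nat.add_sub_cancel]
      calc ‖x‖ ^ m * (((j + 1 : ℕ) : ℝ) * ‖iteratedFDeriv ℝ j f x‖)
          = (j + 1) * (‖x‖ ^ m * ‖iteratedFDeriv ℝ j f x‖) := by push_cast; ring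
        _ ≤ (m + j + a + 1) * (C * (h ^ (m + j) * (m + j + a)!)) := by
            gcongr
            linarith [(Nat.cast_nonneg m : (0 : ℝ) ≤ m), (Nat.cast_nonneg a : (0 : ℝ) ≤ a)]
        _ = C * (1 / (h * (a + 1))) * (h ^ (m + (j + 1)) * ((a + 1) *
              ((m + j + a + 1) * (m + j + a)!))) := by
            field_simp
            ring
        _ ≤ _ := by
            push_cast
            gcongr
            linarith [(Nat.cast_nonneg m : (0 : ℝ) ≤ m), (Nat.cast_nonneg j : (0 : ℝ) ≤ j)]
  calc ‖x‖ ^ m * ‖iteratedFDeriv ℝ j (fun x => l x * f x) x‖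
      ≤ ‖x‖ ^ m * (r * ‖x‖ * ‖iteratedFDeriv ℝ j f x‖ +
          j * (r * ‖iteratedFDeriv ℝ (j - 1) f x‖)) := by gcongr
    _ = r * (‖x‖ ^ (m + 1) * ‖iteratedFDeriv ℝ j f x‖ +
          ‖x‖ ^ m * (j * ‖iteratedFDeriv ℝ (j - 1) f x‖)) := by ring
    _ ≤ r * (C * (h ^ (m + 1 + j) * (m + 1 + j + a)!) +
          C * (1 / (h * (a + 1))) * (h ^ (m + j) * (m + j + (a + 1))!)) := by
        exact mul_le_mul_of_nonneg_left (add_le_add (hf.bound (m + 1) j x) key) hr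
    _ = _ := by
        rw [show m + 1 + j + a = m + j + (a + 1) by ring]; ring

theorem tensor {f : E → ℂ} {g : F → ℂ} (hf : GevreyBound h 0 C f) (hg : GevreyBound h 0 D g)
    (hh : 0 < h) : GevreyBound (2 * h) 0 (2 * (C * D)) (fun p : E × F => f p.1 * g p.2) := by
  have hC := hf.nonneg
  have hD := hg.nonneg
  have c1 : ContDiff ℝ ∞ fun p : E × F => f p.1 := hf.contDiff.comp contDiff_fst
  have c2 : ContDiff ℝ ∞ fun p : E × F => g p.2 := hg.contDiff.comp contDiff_snd
  refine ⟨c1.mul c2, fun m j p => ?_⟩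
  have n1 : ∀ i, ‖iteratedFDeriv ℝ i (fun p : E × F => f p.1) p‖ ≤ ‖iteratedFDeriv ℝ i f p.1‖ :=
    fun i => by
      have e := (ContinuousLinearMap.fst ℝ E F).iteratedFDeriv_comp_right hf.contDiff p
        (i := i) (mod_cast le_top)
      rw [show (fun p : E × F => f p.1) = f ∘ ContinuousLinearMap.fst ℝ E F from rfl, e]
      refine (ContinuousMultilinearMap.norm_compContinuousLinearMap_le _ _).trans ?_
      refine mul_le_of_le_one_right (norm_nonneg _) (Finset.prod_le_one (fun _ _ => norm_nonneg _)
        fun _ _ => ContinuousLinearMap.norm_fst_le ℝ E F)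
  have n2 : ∀ i, ‖iteratedFDeriv ℝ i (fun p : E × F => g p.2) p‖ ≤ ‖iteratedFDeriv ℝ i g p.2‖ :=
    fun i => by
      have e := (ContinuousLinearMap.snd ℝ E F).iteratedFDeriv_comp_right hg.contDiff p
        (i := i) (mod_cast le_top)
      rw [show (fun p : E × F => g p.2) = g ∘ ContinuousLinearMap.snd ℝ E F from rfl, e]
      refine (ContinuousMultilinearMap.norm_compContinuousLinearMap_le _ _).trans ?_
      refine mul_le_of_le_one_right (norm_nonneg _) (Finset.prod_le_one (fun _ _ => norm_nonneg _)
        fun _ _ => ContinuousLinearMap.norm_snd_le ℝ E F)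
  have leib := norm_iteratedFDeriv_mul_le (N := j) (c1.of_le (mod_cast le_top))
    (c2.of_le (mod_cast le_top)) p (n := j) le_rfl
  have hmax : ‖p‖ ^ m ≤ ‖p.1‖ ^ m + ‖p.2‖ ^ m := by
    rcases max_choice ‖p.1‖ ‖p.2‖ with e | e <;> rw [Prod.norm_def, e]
    · linarith [pow_nonneg (norm_nonneg p.2) m]
    · linarith [pow_nonneg (norm_nonneg p.1) m]
  have facle : ∀ i k l : ℕ, i + k = l → ((i ! : ℝ) * k !) ≤ l ! := fun i k l e => by
    rw [← e]
    exact_mod_cast Nat.le_of_dvd (Nat.factorial_pos _)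
      (Nat.factorial_mul_factorial_dvd_factorial_add i k)
  have term : ∀ i ∈ Finset.range (j + 1), ‖p‖ ^ m * ((j.choose i : ℝ) *
      ‖iteratedFDeriv ℝ i (fun p : E × F => f p.1) p‖ *
      ‖iteratedFDeriv ℝ (j - i) (fun p : E × F => g p.2) p‖) ≤
      j.choose i * (2 * (C * D) * (h ^ (m + j) * (m + j)!)) := fun i hi => by
    have hij : i + (j - i) = j := by have := Finset.mem_range.1 hi; omega
    have t1 : ‖p.1‖ ^ m * ‖iteratedFDeriv ℝ i f p.1‖ * ‖iteratedFDeriv ℝ (j - i) g p.2‖ ≤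
        C * D * (h ^ (m + j) * (m + j)!) := by
      have b1 := hf.bound m i p.1
      have b2 := hg.bound 0 (j - i) p.2
      simp only [pow_zero, one_mul, zero_add, add_zero] at b1 b2
      calc _ ≤ C * (h ^ (m + i) * (m + i)!) * (D * (h ^ (j - i) * (j - i)!)) := by gcongr
        _ = C * D * (h ^ (m + i + (j - i)) * ((m + i)! * (j - i)!)) := by rw [pow_add]; ring
        _ ≤ C * D * (h ^ (m + j) * (m + j)!) := by
          rw [add_assoc m i, hij]
          gcongr
          exact facle _ _ _ (by omega)
    have t2 : ‖p.2‖ ^ m * ‖iteratedFDeriv ℝ i f p.1‖ * ‖iteratedFDeriv ℝ (j - i) g p.2‖ ≤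
        C * D * (h ^ (m + j) * (m + j)!) := by
      have b1 := hf.bound 0 i p.1
      have b2 := hg.bound m (j - i) p.2
      simp only [pow_zero, one_mul, zero_add, add_zero] at b1 b2
      calc _ = ‖iteratedFDeriv ℝ i f p.1‖ * (‖p.2‖ ^ m * ‖iteratedFDeriv ℝ (j - i) g p.2‖) := by
            ring
        _ ≤ C * (h ^ i * i !) * (D * (h ^ (m + (j - i)) * (m + (j - i))!)) := by gcongr
        _ = C * D * (h ^ (i + (m + (j - i))) * (i ! * (m + (j - i))!)) := by rw [pow_add]; ring
        _ ≤ C * D * (h ^ (m + j) * (m + j)!) := by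
          rw [show i + (m + (j - i)) = m + j by omega]
          gcongr
          exact facle _ _ _ (by omega)
    calc _ ≤ (‖p.1‖ ^ m + ‖p.2‖ ^ m) * ((j.choose i : ℝ) *
          ‖iteratedFDeriv ℝ i f p.1‖ * ‖iteratedFDeriv ℝ (j - i) g p.2‖) := by
          gcongr
          · exact n1 i
          · exact n2 _
      _ = j.choose i *
          (‖p.1‖ ^ m * ‖iteratedFDeriv ℝ i f p.1‖ * ‖iteratedFDeriv ℝ (j - i) g p.2‖ +
          ‖p.2‖ ^ m * ‖iteratedFDeriv ℝ i f p.1‖ * ‖iteratedFDeriv ℝ (j - i) g p.2‖) := by ring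
      _ ≤ j.choose i * (C * D * (h ^ (m + j) * (m + j)!) + C * D * (h ^ (m + j) * (m + j)!)) := by
          gcongr
      _ = _ := by ring
  calc _ ≤ ‖p‖ ^ m * _ := mul_le_mul_of_nonneg_left leib (by positivity)
    _ ≤ ∑ i ∈ Finset.range (j + 1), j.choose i * (2 * (C * D) * (h ^ (m + j) * (m + j)!)) := by
        rw [Finset.mul_sum]
        exact Finset.sum_le_sum term
    _ = 2 ^ j * (2 * (C * D) * (h ^ (m + j) * (m + j)!)) := by
        rw [← Finset.sum_mul]
        congr 1
        exact_mod_cast Nat.sum_range_choose j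
    _ ≤ 2 ^ (m + j) * (2 * (C * D) * (h ^ (m + j) * (m + j)!)) := by
        gcongr
        · norm_num
        · omega
    _ = _ := by rw [mul_pow, add_zero]; ring

theorem comp_clm {f : F → ℂ} (hf : GevreyBound h 0 C f) (L : E →L[ℝ] F) {K : ℝ}
    (hL : ‖L‖ ≤ K) (hK : ∀ x, ‖x‖ ≤ K * ‖L x‖) : GevreyBound (K * h) 0 C (fun x => f (L x)) := by
  have hK0 : 0 ≤ K := (norm_nonneg L).trans hL
  refine ⟨hf.contDiff.comp L.contDiff, fun m j x => ?_⟩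
  have e := L.iteratedFDeriv_comp_right hf.contDiff x (i := j) (mod_cast le_top)
  rw [show (fun x => f (L x)) = f ∘ L from rfl, e]
  have n1 := (ContinuousMultilinearMap.norm_compContinuousLinearMap_le
    (iteratedFDeriv ℝ j f (L x)) (fun _ => L))
  simp only [Finset.prod_const, Finset.card_univ, Fintype.card_fin] at n1
  calc _ ≤ (K * ‖L x‖) ^ m * (‖iteratedFDeriv ℝ j f (L x)‖ * K ^ j) := by
        gcongr
        · exact hK x
        · exact n1.trans (by gcongr)
    _ = K ^ (m + j) * (‖L x‖ ^ m * ‖iteratedFDeriv ℝ j f (L x)‖) := by ring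
    _ ≤ K ^ (m + j) * (C * (h ^ (m + j) * (m + j + 0)!)) := by
        exact mul_le_mul_of_nonneg_left (hf.bound m j (L x)) (by positivity)
    _ = _ := by ring

end GevreyBound

end GevreyBound

/-! ### Continuous operators on `S^(1)` and on its dual -/

namespace GelfandShilov

variable {E F : Type*} [NormedAddCommGroup E] [NormedSpace ℝ E] [NormedAddCommGroup F]
  [NormedSpace ℝ F]

theorem gevreyBound (f : GelfandShilov E) {h : ℝ} (hh : 0 < h) :
    GevreyBound h 0 (seminorm h h hh hh f) f := by
  refine ⟨f.contDiff, fun m j x => ?_⟩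
  have h1 : quot h h f (m, j, x) ≤ seminorm h h hh hh f :=
    le_ciSup (bddAbove_quot hh hh f) (m, j, x)
  have h0 : 0 ≤ seminorm h h hh hh f := apply_nonneg _ _
  unfold quot at h1
  rw [div_le_iff₀ (by positivity)] at h1
  refine h1.trans (mul_le_mul_of_nonneg_left ?_ h0)
  have h2 : ((m ! : ℝ) * j !) ≤ (m + j)! := by
    exact_mod_cast Nat.le_of_dvd (Nat.factorial_pos _)
      (Nat.factorial_mul_factorial_dvd_factorial_add m j)
  calc h ^ m * m ! * (h ^ j * j !) = h ^ (m + j) * (m ! * j !) := by ring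
    _ ≤ h ^ (m + j) * (m + j + 0)! := by gcongr; exact h2

theorem quot_le_of_gevreyBound {f : E → ℂ} {h A B C : ℝ} (hh : 0 < h) (hA : 2 * h ≤ A)
    (hB : 2 * h ≤ B) (hf : GevreyBound h 0 C f) (m j : ℕ) (x : E) :
    ‖x‖ ^ m * ‖iteratedFDeriv ℝ j f x‖ ≤ C * ((A ^ m * m !) * (B ^ j * j !)) := by
  have hC := hf.nonneg
  refine (hf.bound m j x).trans (mul_le_mul_of_nonneg_left ?_ hC)
  have h2 : ((m + j)! : ℝ) ≤ 2 ^ (m + j) * (m ! * j !) := by exact_mod_cast factorial_add_le m j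
  calc h ^ (m + j) * (m + j + 0)! ≤ h ^ (m + j) * (2 ^ (m + j) * (m ! * j !)) := by
        gcongr; exact h2
    _ = ((2 * h) ^ m * m !) * ((2 * h) ^ j * j !) := by ring
    _ ≤ _ := by
        have : 0 ≤ A := by linarith
        gcongr

theorem seminorm_le_of_gevreyBound {f : GelfandShilov E} {h A B C : ℝ} (hh : 0 < h) (hA : 2 * h ≤ A)
    (hB : 2 * h ≤ B) (hA0 : 0 < A) (hB0 : 0 < B) (hf : GevreyBound h 0 C f) :
    seminorm A B hA0 hB0 f ≤ C := by
  refine ciSup_le fun q => ?_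
  unfold quot
  rw [div_le_iff₀ (by positivity)]
  exact quot_le_of_gevreyBound hh hA hB hf _ _ _

/-- A function with a `GevreyBound` at every scale, as an element of `S^(1)`. -/
def ofGevreyBound (f : E → ℂ) (hf : ∀ h : ℝ, 0 < h → ∃ C, GevreyBound h 0 C f) : GelfandShilov E :=
  ⟨f, (hf 1 one_pos).choose_spec.contDiff, fun A B hA hB => by
    obtain ⟨C, hC⟩ := hf (min A B / 2) (by positivity)
    exact ⟨C, fun k n x => quot_le_of_gevreyBound (by positivity)
      (by linarith [min_le_left A B]) (by linarith [min_le_right A B]) hC k n x⟩⟩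

/-- The linear map underlying `mkCLM`. -/
def mkLinearMap (T : (E → ℂ) → F → ℂ)
    (hadd : ∀ (f g : GelfandShilov E) x, T (fun y => f y + g y) x = T f x + T g x)
    (hsmul : ∀ (c : ℂ) (f : GelfandShilov E) x, T (fun y => c * f y) x = c * T f x)
    (hT : ∀ h : ℝ, 0 < h → ∃ h' : ℝ, 0 < h' ∧ ∃ K : ℝ, 0 ≤ K ∧ ∀ (f : E → ℂ) (C : ℝ),
      GevreyBound h' 0 C f → GevreyBound h 0 (K * C) (T f)) :
    GelfandShilov E →ₗ[ℂ] GelfandShilov F where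
  toFun f := ofGevreyBound (T f) fun h hh => by
    obtain ⟨h', hh', K, -, hK⟩ := hT h hh
    exact ⟨_, hK f _ (f.gevreyBound hh')⟩
  map_add' f g := ext fun x => hadd f g x
  map_smul' c f := ext fun x => hsmul c f x

/-- A linear operation on functions which maps bounds at some scale `h'` to bounds at a given scale
`h`, for every `h`, acts continuously on `S^(1)`. -/
def mkCLM (T : (E → ℂ) → F → ℂ)
    (hadd : ∀ (f g : GelfandShilov E) x, T (fun y => f y + g y) x = T f x + T g x)
    (hsmul : ∀ (c : ℂ) (f : GelfandShilov E) x, T (fun y => c * f y) x = c * T f x)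
    (hT : ∀ h : ℝ, 0 < h → ∃ h' : ℝ, 0 < h' ∧ ∃ K : ℝ, 0 ≤ K ∧ ∀ (f : E → ℂ) (C : ℝ),
      GevreyBound h' 0 C f → GevreyBound h 0 (K * C) (T f)) :
    GelfandShilov E →L[ℂ] GelfandShilov F where
  toLinearMap := mkLinearMap T hadd hsmul hT
  cont := by
    refine withSeminorms.continuous_of_isBounded withSeminorms (mkLinearMap T hadd hsmul hT) ?_
    rintro ⟨⟨A, hA⟩, ⟨B, hB⟩⟩
    have hA : 0 < A := hA
    have hB : 0 < B := hB
    have h0 : 0 < min A B / 2 := by positivity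
    obtain ⟨h', hh', K, hK0, hK⟩ := hT (min A B / 2) h0
    refine ⟨{(⟨h', hh'⟩, ⟨h', hh'⟩)}, ⟨K, hK0⟩, fun f => ?_⟩
    rw [Finset.sup_singleton]
    exact seminorm_le_of_gevreyBound h0 (by linarith [min_le_left A B])
      (by linarith [min_le_right A B]) hA hB (hK f _ (f.gevreyBound hh'))

/-- The tensor product `(x, y) ↦ f x * g y`, as a continuous operator in `g`. -/
def tensor (f : GelfandShilov E) : GelfandShilov F →L[ℂ] GelfandShilov (E × F) :=
  mkCLM (fun g p => f p.1 * g p.2) (fun _ _ _ => mul_add _ _ _) (fun _ _ _ => mul_left_comm _ _ _)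
    fun h hh => by
      have h2 : 0 < h / 2 := by positivity
      refine ⟨h / 2, h2, 2 * seminorm _ _ h2 h2 f, mul_nonneg zero_le_two (apply_nonneg _ _),
        fun g C hg => ?_⟩
      have := (f.gevreyBound h2).tensor hg h2
      rwa [mul_div_cancel₀ _ (two_ne_zero), ← mul_assoc] at this

@[simp] theorem tensor_apply (f : GelfandShilov E) (g : GelfandShilov F) (p : E × F) :
    tensor f g p = f p.1 * g p.2 := rfl

/-- Composition with an injective linear map `L`; the injectivity is quantified by `K`. -/
def compCLM (L : E →L[ℝ] F) (K : ℝ) (hK : ∀ x, ‖x‖ ≤ K * ‖L x‖) :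
    GelfandShilov F →L[ℂ] GelfandShilov E :=
  mkCLM (fun f x => f (L x)) (fun _ _ _ => rfl) (fun _ _ _ => rfl) fun h hh => by
    have hM : 0 < max 1 (max K ‖L‖) := lt_max_of_lt_left one_pos
    refine ⟨h / max 1 (max K ‖L‖), by positivity, 1, zero_le_one, fun f C hf => ?_⟩
    have := hf.comp_clm L (K := max 1 (max K ‖L‖))
      ((le_max_right _ _).trans (le_max_right _ _)) fun x => (hK x).trans (by
        gcongr
        exact (le_max_left _ _).trans (le_max_right _ _))
    rwa [mul_div_cancel₀ _ hM.ne', ← one_mul C] at this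

@[simp] theorem compCLM_apply (L : E →L[ℝ] F) (K : ℝ) (hK : ∀ x, ‖x‖ ≤ K * ‖L x‖)
    (f : GelfandShilov F) (x : E) : compCLM L K hK f x = f (L x) := rfl

theorem seminorm_anti {A B h : ℝ} (hA : 0 < A) (hB : 0 < B) (hh : 0 < h) (h1 : h ≤ A) (h2 : h ≤ B) :
    seminorm A B hA hB ≤ (seminorm h h hh hh : Seminorm ℂ (GelfandShilov E)) := by
  intro f
  refine ciSup_le fun q => le_trans ?_ (le_ciSup (bddAbove_quot hh hh f) q)
  unfold quot
  gcongr

/-- A continuous functional is bounded by a single seminorm, as the family is directed. -/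
theorem exists_norm_apply_le (u : Ultradistribution E) :
    ∃ (h : ℝ) (hh : 0 < h) (C : ℝ), 0 ≤ C ∧ ∀ f, ‖u f‖ ≤ C * seminorm h h hh hh f := by
  obtain ⟨s, C, -, hC⟩ := Seminorm.bound_of_continuous withSeminorms
    ((normSeminorm ℂ ℂ).comp u.toLinearMap) (u.continuous.norm)
  have : ∃ (h : ℝ) (hh : 0 < h), s.sup (seminormFamily E) ≤ seminorm h h hh hh := by
    clear hC
    induction s using Finset.cons_induction with
    | empty => exact ⟨1, one_pos, bot_le⟩
    | cons i s hi ih =>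
      obtain ⟨h, hh, hs⟩ := ih
      have hi1 : 0 < i.1.1 := i.1.2
      have hi2 : 0 < i.2.1 := i.2.2
      refine ⟨min h (min i.1.1 i.2.1), by positivity, ?_⟩
      rw [Finset.sup_cons]
      refine sup_le (seminorm_anti _ _ _ ?_ ?_) (hs.trans (seminorm_anti _ _ _ ?_ ?_)) <;> simp
  obtain ⟨h, hh, hs⟩ := this
  exact ⟨h, hh, C, C.2, fun f => (hC f).trans (mul_le_mul_of_nonneg_left (hs f) C.2)⟩

/-- The linear map underlying `kernelOperator`. -/
def kernelLinearMap (u : Ultradistribution (E × F)) :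
    GelfandShilov E →ₗ[ℂ] Ultradistribution F where
  toFun f := u ∘L tensor f
  map_add' f g := by
    ext k
    have e : tensor (f + g) k = tensor f k + tensor g k := ext fun p => add_mul _ _ _
    exact (congrArg u e).trans (map_add u _ _)
  map_smul' c f := by
    ext k
    have e : tensor (c • f) k = c • tensor f k := ext fun p => mul_assoc _ _ _
    exact (congrArg u e).trans (map_smul u _ _)

/-- A functional on `S^(1)(E × F)`, as the operator `f ↦ (g ↦ u (f ⊗ g))` with values in the strong
dual: the easy half of the kernel theorem. -/
def kernelOperator (u : Ultradistribution (E × F)) :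
    GelfandShilov E →L[ℂ] Ultradistribution F where
  toLinearMap := kernelLinearMap u
  cont := by
    refine continuous_of_continuousAt_zero (kernelLinearMap u) ?_
    obtain ⟨h, hh, C, hC, hu⟩ := exists_norm_apply_le u
    have h4 : 0 < h / 4 := by positivity
    have key : ∀ (f : GelfandShilov E) (g : GelfandShilov F), ‖u (tensor f g)‖ ≤
        C * (2 * (seminorm _ _ h4 h4 f * seminorm _ _ h4 h4 g)) := fun f g => by
      refine (hu _).trans (mul_le_mul_of_nonneg_left ?_ hC)
      exact seminorm_le_of_gevreyBound (h := 2 * (h / 4)) (by positivity) (by linarith)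
        (by linarith) hh hh ((f.gevreyBound h4).tensor (g.gevreyBound h4) h4)
    unfold ContinuousAt
    rw [map_zero, (ContinuousLinearMap.hasBasis_nhds_zero_of_basis
      Metric.nhds_basis_ball).tendsto_right_iff]
    rintro ⟨S, ε⟩ ⟨hS, hε⟩
    obtain ⟨r, hr, hSr⟩ := (withSeminorms.isVonNBounded_iff_seminorm_bounded.1 hS)
      (⟨h / 4, h4⟩, ⟨h / 4, h4⟩)
    have hcont : Continuous (seminorm _ _ h4 h4 : Seminorm ℂ (GelfandShilov E)) :=
      withSeminorms.continuous_seminorm (p := seminormFamily E) (⟨h / 4, h4⟩, ⟨h / 4, h4⟩)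
    have hlim : Filter.Tendsto (fun f : GelfandShilov E => C * (2 * (seminorm _ _ h4 h4 f * r)))
        (nhds 0) (nhds 0) := by
      have : Continuous fun f : GelfandShilov E => C * (2 * (seminorm _ _ h4 h4 f * r)) := by
        fun_prop
      simpa using this.tendsto 0
    filter_upwards [hlim.eventually (gt_mem_nhds hε)] with f hf g hg
    rw [mem_ball_zero_iff]
    refine (key f g).trans_lt (lt_of_le_of_lt ?_ hf)
    have h1 : seminorm _ _ h4 h4 g ≤ r := (hSr g hg).le
    have h2 : 0 ≤ seminorm _ _ h4 h4 f := apply_nonneg _ _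
    gcongr

end GelfandShilov

/-! ### Partial Fourier integrals -/

/-- For a natural number `q` the product is the binomial coefficient `(q + n).choose n`, which grows
geometrically in `n`. -/
theorem exists_prod_one_add_div_le (q : ℝ) :
    ∃ P : ℝ, 0 ≤ P ∧ ∀ n : ℕ, ∏ i ∈ Finset.range n, |1 + q / (i + 1)| ≤ P * 2 ^ n := by
  obtain ⟨M, hM⟩ := exists_nat_ge |q|
  have hprod : ∀ n : ℕ, ∏ i ∈ Finset.range n, (1 + (M : ℝ) / (i + 1)) = (M + n).choose n := by
    intro n
    induction n with
    | zero => simp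
    | succ n ih =>
      have e : ((M + n + 1 : ℕ) : ℝ) * (M + n).choose n
          = (M + n + 1).choose (n + 1) * ((n + 1 : ℕ) : ℝ) := by
        exact_mod_cast Nat.add_one_mul_choose_eq (M + n) n
      rw [Finset.prod_range_succ, ih]
      push_cast at e
      field_simp
      rw [← add_assoc M n 1]
      linear_combination e
  refine ⟨2 ^ M, by positivity, fun n => ?_⟩
  calc _ ≤ ∏ i ∈ Finset.range n, (1 + (M : ℝ) / (i + 1)) := by
        refine Finset.prod_le_prod (fun _ _ => abs_nonneg _) fun i _ => ?_
        refine (abs_add_le _ _).trans ?_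
        rw [abs_one, abs_div, abs_of_pos (show (0 : ℝ) < i + 1 by positivity)]
        gcongr
    _ = (M + n).choose n := hprod n
    _ ≤ 2 ^ (M + n) := by exact_mod_cast Nat.choose_le_two_pow _ _
    _ = _ := pow_add _ _ _

/-- The operator norm of the derivative of order `n + 1` is controlled by the derivatives of order
`n` of the directional derivatives. -/
theorem norm_iteratedFDeriv_succ_le_of_fderiv_apply {E : Type*} [NormedAddCommGroup E]
    [NormedSpace ℝ E] {g : E → ℂ} (hg : ContDiff ℝ ∞ g) {n : ℕ} {x : E} {M : ℝ} (hM : 0 ≤ M)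
    (h : ∀ v : E, ‖v‖ ≤ 1 → ‖iteratedFDeriv ℝ n (fun y => fderiv ℝ g y v) x‖ ≤ M) :
    ‖iteratedFDeriv ℝ (n + 1) g x‖ ≤ M := by
  rw [← norm_iteratedFDeriv_fderiv]
  have hd : ContDiff ℝ ∞ (fderiv ℝ g) := hg.fderiv_right (by simp)
  refine ContinuousMultilinearMap.opNorm_le_bound hM fun m => ?_
  refine ContinuousLinearMap.opNorm_le_of_unit_norm (by positivity) fun v hv => ?_
  have e := (ContinuousLinearMap.apply ℝ ℂ v).iteratedFDeriv_comp_left (f := fderiv ℝ g) (x := x)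
    (hd.contDiffAt) (i := n) (mod_cast le_top)
  have e' : iteratedFDeriv ℝ n (fderiv ℝ g) x m v =
      iteratedFDeriv ℝ n (fun y => fderiv ℝ g y v) x m :=
    (congrArg (fun T => T m) e).symm
  rw [e']
  exact (ContinuousMultilinearMap.le_opNorm _ m).trans (by gcongr; exact h v hv.le)

section OscillatoryIntegral

variable {X Y S : Type*} [NormedAddCommGroup X] [NormedSpace ℝ X] [NormedAddCommGroup Y]
  [NormedSpace ℝ Y] [NormedAddCommGroup S] [NormedSpace ℝ S]

/-- The partial Fourier integral `y ↦ ∫ exp(i b(s, y)) Φ(π y, s) ds`. With `π` a projection and `b` a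
multiple of the inner product with the other component it is a partial Fourier transform; with `b = 0`
it is integration over `s`. -/
def oscillatoryIntegral [MeasureSpace S] (π : Y →L[ℝ] X) (b : S →L[ℝ] Y →L[ℝ] ℝ) (Φ : X × S → ℂ)
    (y : Y) : ℂ :=
  ∫ s, Complex.exp (Complex.I * (b s y : ℝ)) * Φ (π y, s)

/-- The amplitude of the derivative of an oscillatory integral in the direction `v`. -/
def oscillatoryDeriv (π : Y →L[ℝ] X) (b : S →L[ℝ] Y →L[ℝ] ℝ) (v : Y) (Φ : X × S → ℂ)
    (p : X × S) : ℂ :=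
  fderiv ℝ Φ p (π v, 0) + Complex.I * (b p.2 v : ℝ) * Φ p

theorem norm_exp_I_mul_ofReal (r : ℝ) : ‖Complex.exp (Complex.I * (r : ℝ))‖ = 1 := by
  rw [mul_comm, Complex.norm_exp_ofReal_mul_I]

variable {π : Y →L[ℝ] X} {b : S →L[ℝ] Y →L[ℝ] ℝ} {Φ : X × S → ℂ} {h C κ : ℝ} {a : ℕ}

/-- One derivative of an oscillatory integral costs its amplitude one factorial, whether the derivative
falls on the amplitude or on the phase. -/
theorem GevreyBound.oscillatoryDeriv (hΦ : GevreyBound h a C Φ) (hh : 0 < h) (hπ : ‖π‖ ≤ κ)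
    (hb : ‖b‖ ≤ κ) {v : Y} (hv : ‖v‖ ≤ 1) :
    GevreyBound h (a + 1) (C * (κ * (2 * h + 1 / (h * (a + 1)))))
      (oscillatoryDeriv π b v Φ) := by
  have h1 : ‖((π v, 0) : X × S)‖ ≤ κ := by
    rw [Prod.norm_mk, norm_zero, max_eq_left (norm_nonneg _)]
    exact (π.le_of_opNorm_le_of_le hπ hv).trans_eq (mul_one κ)
  set l : X × S →L[ℝ] ℂ :=
    (Complex.I • Complex.ofRealCLM) ∘L (b.flip v) ∘L (ContinuousLinearMap.snd ℝ X S) with hl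
  have h2 : ‖l‖ ≤ κ := by
    refine ContinuousLinearMap.opNorm_le_bound _ ((norm_nonneg _).trans hπ) fun p => ?_
    have e : l p = Complex.I * (b p.2 v : ℝ) := rfl
    rw [e, norm_mul, Complex.norm_I, one_mul, Complex.norm_real]
    calc ‖b p.2 v‖ ≤ ‖b‖ * ‖p.2‖ * ‖v‖ := b.le_opNorm₂ _ _
      _ ≤ κ * ‖p‖ * 1 := by
        have : 0 ≤ κ := (norm_nonneg _).trans hπ
        gcongr
        exact norm_snd_le p
      _ = _ := mul_one _
  have e := (hΦ.fderiv_apply h1).add (hΦ.clm_mul l h2 hh)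
  have e2 : κ * (C * h) + κ * (C * (h + 1 / (h * (a + 1)))) =
      C * (κ * (2 * h + 1 / (h * (a + 1)))) := by ring
  rw [e2] at e
  exact e

variable [MeasureSpace S] [BorelSpace S] [FiniteDimensional ℝ S]
  [(volume : Measure S).IsAddHaarMeasure]

/-- Slices of a function in `S^(1)` are integrable with the same kind of bounds; the order of the
factorial increases by a fixed amount. -/
theorem exists_slice_bound (X S : Type*) [NormedAddCommGroup X] [NormedSpace ℝ X]
    [NormedAddCommGroup S] [NormedSpace ℝ S] [MeasureSpace S] [BorelSpace S]
    [FiniteDimensional ℝ S] [(volume : Measure S).IsAddHaarMeasure] {h : ℝ} (hh : 0 < h) :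
    ∃ (N : ℕ) (w : S → ℝ), Integrable w ∧ (∀ s, 0 ≤ w s) ∧
      ∀ (a : ℕ) (C : ℝ) (Φ : X × S → ℂ), GevreyBound h a C Φ → ∀ (k : ℕ) (x : X) (s : S),
        ‖x‖ ^ k * ‖Φ (x, s)‖ ≤ C * (h ^ k * (k + N + a)!) * w s := by
  set N := Module.finrank ℝ S + 1 with hN
  refine ⟨N, fun s => (2 ^ N * (1 + h ^ N)) * (1 + ‖s‖) ^ (-(N : ℝ)), ?_, fun s => by positivity,
    fun a C Φ hΦ k x s => ?_⟩
  · exact (integrable_one_add_norm (by rw [hN]; push_cast; linarith)).const_mul _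
  have hC := hΦ.nonneg
  have hs : 0 < (1 + ‖s‖) := by positivity
  beta_reduce
  rw [Real.rpow_neg hs.le, Real.rpow_natCast, ← mul_assoc, ← div_eq_mul_inv,
    le_div_iff₀ (by positivity)]
  have hx1 : ‖x‖ ≤ ‖(x, s)‖ := norm_fst_le (x, s)
  have hs1 : ‖s‖ ≤ ‖(x, s)‖ := norm_snd_le (x, s)
  have b0 := hΦ.norm_pow_mul_le k (x, s)
  have b1 := hΦ.norm_pow_mul_le (k + N) (x, s)
  have hpow : (1 + ‖s‖) ^ N ≤ 2 ^ N * (1 + ‖s‖ ^ N) := by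
    refine (add_pow_le zero_le_one (norm_nonneg s) N).trans ?_
    rw [one_pow]
    gcongr
    · norm_num
    · omega
  have hf : ((k + a)! : ℝ) ≤ (k + N + a)! := by
    exact_mod_cast Nat.factorial_le (by omega)
  calc ‖x‖ ^ k * ‖Φ (x, s)‖ * (1 + ‖s‖) ^ N
      ≤ ‖(x, s)‖ ^ k * ‖Φ (x, s)‖ * (2 ^ N * (1 + ‖(x, s)‖ ^ N)) := by
        gcongr
        exact hpow.trans (by gcongr)
    _ = 2 ^ N * (‖(x, s)‖ ^ k * ‖Φ (x, s)‖ + ‖(x, s)‖ ^ (k + N) * ‖Φ (x, s)‖) := by ring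
    _ ≤ 2 ^ N * (C * (h ^ k * (k + N + a)!) + C * (h ^ (k + N) * (k + N + a)!)) := by
        refine mul_le_mul_of_nonneg_left (add_le_add (b0.trans ?_) b1) (by positivity)
        gcongr
    _ = _ := by ring

namespace GevreyBound

theorem integrable_slice (hΦ : GevreyBound h a C Φ) (hh : 0 < h) (x : X) :
    Integrable fun s => Φ (x, s) := by
  obtain ⟨N, w, hw, -, H⟩ := exists_slice_bound X S hh
  have : ProperSpace S := FiniteDimensional.proper_real S
  refine (hw.const_mul (C * (h ^ 0 * (0 + N + a)!))).mono'
    ((hΦ.contDiff.continuous.comp (by fun_prop)).aestronglyMeasurable)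
    (Filter.Eventually.of_forall fun s => ?_)
  simpa using H a C Φ hΦ 0 x s

theorem integrable_exp_mul_slice (hΦ : GevreyBound h a C Φ) (hh : 0 < h) (y : Y) (x : X) :
    Integrable fun s => Complex.exp (Complex.I * (b s y : ℝ)) * Φ (x, s) := by
  have : ProperSpace S := FiniteDimensional.proper_real S
  refine (hΦ.integrable_slice hh x).bdd_mul (c := 1) (Continuous.aestronglyMeasurable ?_)
    (Filter.Eventually.of_forall fun s => (norm_exp_I_mul_ofReal _).le)
  have : Continuous fun s => b s y := (b.flip y).continuous
  fun_prop

/-- Differentiation under the integral sign. -/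
theorem fderiv_oscillatoryIntegral (hΦ : GevreyBound h a C Φ) (hh : 0 < h) (y : Y) :
    DifferentiableAt ℝ (oscillatoryIntegral π b Φ) y ∧
      ∀ v, fderiv ℝ (oscillatoryIntegral π b Φ) y v =
        oscillatoryIntegral π b (_root_.oscillatoryDeriv π b v Φ) y := by
  have : ProperSpace S := FiniteDimensional.proper_real S
  obtain ⟨N, w, hw, hw0, H⟩ := exists_slice_bound X S hh
  have hΦc := hΦ.contDiff.continuous
  have hΦd : Continuous (fderiv ℝ Φ) := hΦ.contDiff.continuous_fderiv (by simp)
  set F' : Y → S → Y →L[ℝ] ℂ := fun y s => Complex.exp (Complex.I * (b s y : ℝ)) •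
    ((fderiv ℝ Φ (π y, s)) ∘L (ContinuousLinearMap.inl ℝ X S ∘L π) +
      Φ (π y, s) • ((Complex.I • Complex.ofRealCLM) ∘L b s)) with hF'
  have hF'v : ∀ y s v, F' y s v = Complex.exp (Complex.I * (b s y : ℝ)) *
      _root_.oscillatoryDeriv π b v Φ (π y, s) := fun y s v => by
    simp [hF', _root_.oscillatoryDeriv]
    ring
  set κ := max ‖π‖ ‖b‖ with hκ
  have hbound : ∀ y s, ‖F' y s‖ ≤
      C * (κ * (2 * h + 1 / (h * (a + 1)))) * (h ^ 0 * (0 + N + (a + 1))!) * w s := fun y s => by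
    have hC := hΦ.nonneg
    have h0 := hw0 s
    refine ContinuousLinearMap.opNorm_le_of_unit_norm (by positivity) fun v hv => ?_
    rw [hF'v, norm_mul, norm_exp_I_mul_ofReal]
    simpa using H _ _ _ (hΦ.oscillatoryDeriv hh (le_max_left _ _) (le_max_right _ _) hv.le) 0 (π y) s
  have hmeas : AEStronglyMeasurable (F' y) (volume : Measure S) := by
    have h1 : Continuous fun s => b s y := (b.flip y).continuous
    refine Continuous.aestronglyMeasurable ?_
    fun_prop
  have hdiff : ∀ s y, HasFDerivAt
      (fun y => Complex.exp (Complex.I * (b s y : ℝ)) * Φ (π y, s)) (F' y s) y := fun s y => by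
    have d1 : HasFDerivAt (fun y => Complex.I * (b s y : ℝ))
        ((Complex.I • Complex.ofRealCLM) ∘L b s) y :=
      ((Complex.I • Complex.ofRealCLM) ∘L b s).hasFDerivAt
    have d2 : HasFDerivAt (fun y => ((π y, s) : X × S)) (ContinuousLinearMap.inl ℝ X S ∘L π) y := by
      have := (π.hasFDerivAt (x := y)).prodMk (hasFDerivAt_const s y)
      convert! this using 1
    have d3 := ((hΦ.contDiff.differentiable (by simp)) (π y, s)).hasFDerivAt.comp y d2
    convert! d1.cexp.mul d3 using 1
    ext v
    rw [hF'v]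
    simp [_root_.oscillatoryDeriv]
    ring
  have key := hasFDerivAt_integral_of_dominated_of_fderiv_le
    (F := fun y s => Complex.exp (Complex.I * (b s y : ℝ)) * Φ (π y, s)) (F' := F')
    (μ := (volume : Measure S)) (x₀ := y) Filter.univ_mem
    (Filter.Eventually.of_forall fun y => (hΦ.integrable_exp_mul_slice hh y (π y)).1)
    (hΦ.integrable_exp_mul_slice hh y (π y)) hmeas
    (Filter.Eventually.of_forall fun s y _ => hbound y s) (hw.const_mul _)
    (Filter.Eventually.of_forall fun s y _ => hdiff s y)
  refine ⟨key.differentiableAt, fun v => ?_⟩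
  have e : fderiv ℝ (oscillatoryIntegral π b Φ) y = ∫ s, F' y s := key.fderiv
  have hint : Integrable (F' y) :=
    (hw.const_mul _).mono' hmeas (Filter.Eventually.of_forall fun s => hbound y s)
  rw [e, ContinuousLinearMap.integral_apply hint]
  exact integral_congr_ae (Filter.Eventually.of_forall fun s => hF'v y s v)

theorem contDiff_oscillatoryIntegral [FiniteDimensional ℝ Y] (hΦ : GevreyBound h a C Φ)
    (hh : 0 < h) : ContDiff ℝ ∞ (oscillatoryIntegral π b Φ) := by
  rw [contDiff_infty]
  intro n
  induction n generalizing a C Φ with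
  | zero =>
    exact contDiff_zero.2 (continuous_iff_continuousAt.2 fun y =>
      (hΦ.fderiv_oscillatoryIntegral hh y).1.continuousAt)
  | succ n ih =>
    rw [Nat.cast_add, Nat.cast_one, contDiff_succ_iff_fderiv_apply]
    refine ⟨fun y => (hΦ.fderiv_oscillatoryIntegral hh y).1, by simp, fun v => ?_⟩
    have e : (fun y => fderiv ℝ (oscillatoryIntegral π b Φ) y v) =
        oscillatoryIntegral π b (_root_.oscillatoryDeriv π b v Φ) :=
      funext fun y => (hΦ.fderiv_oscillatoryIntegral hh y).2 v
    rw [e]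
    -- `oscillatoryDeriv` is linear in the direction, so directions of norm at most one suffice
    have hv0 : 0 < 1 + ‖v‖ := by positivity
    have hv : ‖(1 + ‖v‖)⁻¹ • v‖ ≤ 1 := by
      rw [norm_smul, norm_inv, Real.norm_of_nonneg hv0.le, inv_mul_le_iff₀ hv0]
      linarith
    have e2 : _root_.oscillatoryDeriv π b v Φ = fun p => ((1 + ‖v‖ : ℝ) : ℂ) *
        _root_.oscillatoryDeriv π b ((1 + ‖v‖)⁻¹ • v) Φ p := by
      funext p
      have e3 : ((π ((1 + ‖v‖)⁻¹ • v), 0) : X × S) = (1 + ‖v‖)⁻¹ • (π v, 0) := by simp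
      have e4 : ((1 + ‖v‖ : ℝ) : ℂ) ≠ 0 := by exact_mod_cast hv0.ne'
      unfold _root_.oscillatoryDeriv
      rw [e3, map_smul, map_smul, Complex.real_smul, smul_eq_mul, Complex.ofReal_mul,
        Complex.ofReal_inv]
      field_simp
    rw [e2]
    exact ih ((hΦ.oscillatoryDeriv hh (le_max_left ‖π‖ ‖b‖) (le_max_right _ _) hv).const_mul _)

/-- Integration by parts in an oscillatory integral. -/
theorem mul_oscillatoryIntegral (hΦ : GevreyBound h a C Φ) (hh : 0 < h) (y : Y) (η : S) :
    Complex.I * (b η y : ℝ) * oscillatoryIntegral π b Φ y =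
      -oscillatoryIntegral π b (fun p => fderiv ℝ Φ p (0, η)) y := by
  have hd := hΦ.fderiv_apply (v := ((0, η) : X × S)) le_rfl
  have i1 := hΦ.integrable_exp_mul_slice (b := b) hh y (π y)
  have i2 := hd.integrable_exp_mul_slice (b := b) hh y (π y)
  have i3 := i1.const_mul (Complex.I * (b η y : ℝ))
  have hdiff : ∀ s, HasFDerivAt
      (fun s => Complex.exp (Complex.I * (b s y : ℝ)) * Φ (π y, s))
      (Complex.exp (Complex.I * (b s y : ℝ)) • ((fderiv ℝ Φ (π y, s)) ∘L
        (ContinuousLinearMap.inr ℝ X S)) + Φ (π y, s) • (Complex.exp (Complex.I * (b s y : ℝ)) •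
        ((Complex.I • Complex.ofRealCLM) ∘L b.flip y))) s := fun s => by
    have d1 : HasFDerivAt (fun s => Complex.I * (b s y : ℝ))
        ((Complex.I • Complex.ofRealCLM) ∘L b.flip y) s :=
      ((Complex.I • Complex.ofRealCLM) ∘L b.flip y).hasFDerivAt
    have d2 : HasFDerivAt (fun s => ((π y, s) : X × S)) (ContinuousLinearMap.inr ℝ X S) s := by
      have := (hasFDerivAt_const (π y) s).prodMk (hasFDerivAt_id (𝕜 := ℝ) s)
      convert! this using 1
    have d3 := ((hΦ.contDiff.differentiable (by simp)) (π y, s)).hasFDerivAt.comp s d2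
    exact d1.cexp.mul d3
  have hval : ∀ s, fderiv ℝ (fun s => Complex.exp (Complex.I * (b s y : ℝ)) * Φ (π y, s)) s η =
      Complex.exp (Complex.I * (b s y : ℝ)) * fderiv ℝ Φ (π y, s) (0, η) +
        Complex.I * (b η y : ℝ) * (Complex.exp (Complex.I * (b s y : ℝ)) * Φ (π y, s)) := fun s => by
    rw [(hdiff s).fderiv]
    simp
    ring
  have hibp := integral_mul_fderiv_eq_neg_fderiv_mul_of_integrable (μ := (volume : Measure S))
    (f := fun _ : S => (1 : ℂ))
    (g := fun s => Complex.exp (Complex.I * (b s y : ℝ)) * Φ (π y, s)) (v := η)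
    (by simp) (by simp only [one_mul, hval]; exact i2.add i3) (by simpa only [one_mul] using i1)
    (fun _ _ => differentiableAt_const _) (fun s _ => (hdiff s).differentiableAt)
  simp only [one_mul, hval, fderiv_fun_const, Pi.zero_apply, zero_apply,
    zero_mul, integral_zero, neg_zero] at hibp
  rw [integral_add i2 i3, integral_const_mul] at hibp
  unfold oscillatoryIntegral
  linear_combination hibp

end GevreyBound

/-- Oscillatory integrals preserve the bounds defining `S^(1)`, if every `y` is controlled by `π y` or
by the frequencies `b η y`. -/
theorem exists_gevreyBound_oscillatoryIntegral [FiniteDimensional ℝ Y] {c : ℝ}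
    (hY : ∀ y, ‖y‖ ≤ c * ‖π y‖ ∨ ∃ η : S, ‖η‖ ≤ 1 ∧ ‖y‖ ≤ c * |b η y|) {h₁ : ℝ} (hh₁ : 0 < h₁) :
    ∃ h : ℝ, 0 < h ∧ ∃ K : ℝ, 0 ≤ K ∧ ∀ (Φ : X × S → ℂ) (C : ℝ),
      GevreyBound h 0 C Φ → GevreyBound h₁ 0 (K * C) (oscillatoryIntegral π b Φ) := by
  set κ := max ‖π‖ ‖b‖ with hκ
  have hκ0 : 0 ≤ κ := (norm_nonneg π).trans (le_max_left _ _)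
  set R := 2 * |c| + 8 * κ + 1 with hR
  have hR0 : 0 < R := by positivity
  set h := h₁ / R with hdef
  have hh : 0 < h := by positivity
  obtain ⟨N, w, hw, hw0, H⟩ := exists_slice_bound X S hh
  obtain ⟨P, hP0, hP⟩ := exists_prod_one_add_div_le (1 / (2 * h ^ 2))
  set J := ∫ s, w s with hJ
  have hJ0 : 0 ≤ J := integral_nonneg hw0
  -- decay in `π y`
  have base1 : ∀ (a : ℕ) (C : ℝ) (Φ : X × S → ℂ), GevreyBound h a C Φ → ∀ (k : ℕ) (y : Y),
      ‖π y‖ ^ k * ‖oscillatoryIntegral π b Φ y‖ ≤ J * (C * (h ^ k * (k + N + a)!)) := by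
    intro a C Φ hΦ k y
    have e : ((‖π y‖ ^ k : ℝ) : ℂ) * oscillatoryIntegral π b Φ y = ∫ s, ((‖π y‖ ^ k : ℝ) : ℂ) *
        (Complex.exp (Complex.I * (b s y : ℝ)) * Φ (π y, s)) := (integral_const_mul _ _).symm
    have e2 : ‖π y‖ ^ k * ‖oscillatoryIntegral π b Φ y‖ =
        ‖((‖π y‖ ^ k : ℝ) : ℂ) * oscillatoryIntegral π b Φ y‖ := by
      rw [norm_mul, Complex.norm_real, Real.norm_of_nonneg (by positivity)]
    rw [e2, e, mul_comm J, ← integral_const_mul]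
    refine norm_integral_le_of_norm_le (hw.const_mul _) (Filter.Eventually.of_forall fun s => ?_)
    rw [norm_mul, norm_mul, norm_exp_I_mul_ofReal, one_mul, Complex.norm_real,
      Real.norm_of_nonneg (by positivity)]
    exact H a C Φ hΦ k (π y) s
  -- decay in the frequency variables
  have base2 : ∀ (η : S), ‖η‖ ≤ 1 → ∀ (y : Y) (k a : ℕ) (C : ℝ) (Φ : X × S → ℂ),
      GevreyBound h a C Φ →
      |b η y| ^ k * ‖oscillatoryIntegral π b Φ y‖ ≤ J * (C * (h ^ k * (k + N + a)!)) := by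
    intro η hη y k
    induction k with
    | zero =>
      intro a C Φ hΦ
      simpa using base1 a C Φ hΦ 0 y
    | succ k ih =>
      intro a C Φ hΦ
      have hη' : ‖((0, η) : X × S)‖ ≤ 1 := by
        rw [Prod.norm_mk, norm_zero, max_eq_right (norm_nonneg _)]
        exact hη
      have e := congrArg norm (hΦ.mul_oscillatoryIntegral (π := π) (b := b) hh y η)
      rw [norm_neg, norm_mul, norm_mul, Complex.norm_I, one_mul, Complex.norm_real,
        Real.norm_eq_abs] at e
      rw [pow_succ, mul_assoc, e]
      refine (ih _ _ _ (hΦ.fderiv_apply hη')).trans_eq ?_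
      rw [show k + N + (a + 1) = k + 1 + N + a by ring]
      ring
  have base : ∀ (k a : ℕ) (C : ℝ) (Φ : X × S → ℂ), GevreyBound h a C Φ → ∀ y : Y,
      ‖y‖ ^ k * ‖oscillatoryIntegral π b Φ y‖ ≤
        |c| ^ k * (J * (C * (h ^ k * (k + N + a)!))) := by
    intro k a C Φ hΦ y
    have hc := le_abs_self c
    rcases hY y with h1 | ⟨η, hη, h1⟩
    · refine le_trans ?_ (mul_le_mul_of_nonneg_left (base1 a C Φ hΦ k y) (by positivity))
      rw [← mul_assoc, ← mul_pow]
      gcongr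
      exact h1.trans (by gcongr)
    · refine le_trans ?_ (mul_le_mul_of_nonneg_left (base2 η hη y k a C Φ hΦ) (by positivity))
      rw [← mul_assoc, ← mul_pow]
      gcongr
      exact h1.trans (by gcongr)
  -- each derivative costs one factorial
  have iter : ∀ (n k a : ℕ) (C : ℝ) (Φ : X × S → ℂ), GevreyBound h a C Φ → ∀ y : Y,
      ‖y‖ ^ k * ‖iteratedFDeriv ℝ n (oscillatoryIntegral π b Φ) y‖ ≤
        |c| ^ k * (J * (C * (∏ i ∈ Finset.range n, κ * (2 * h + 1 / (h * (a + i + 1)))) *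
          (h ^ k * (k + N + a + n)!))) := by
    intro n k
    induction n with
    | zero =>
      intro a C Φ hΦ y
      simpa using base k a C Φ hΦ y
    | succ n ih =>
      intro a C Φ hΦ y
      have hC := hΦ.nonneg
      rcases eq_or_ne (‖y‖ ^ k) 0 with h0 | h0
      · rw [h0, zero_mul]
        positivity
      have hpos : 0 < ‖y‖ ^ k := lt_of_le_of_ne (by positivity) h0.symm
      rw [mul_comm, ← le_div_iff₀ hpos]
      refine norm_iteratedFDeriv_succ_le_of_fderiv_apply (hΦ.contDiff_oscillatoryIntegral hh)
        (by positivity) fun v hv => ?_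
      have e : (fun y => fderiv ℝ (oscillatoryIntegral π b Φ) y v) =
          oscillatoryIntegral π b (oscillatoryDeriv π b v Φ) :=
        funext fun y => (hΦ.fderiv_oscillatoryIntegral hh y).2 v
      rw [e, le_div_iff₀ hpos, mul_comm]
      refine (ih _ _ _ (hΦ.oscillatoryDeriv hh (le_max_left _ _) (le_max_right _ _) hv) y).trans_eq ?_
      rw [Finset.prod_range_succ', show k + N + (a + 1) + n = k + N + a + (n + 1) by ring]
      have e3 : ∀ i : ℕ, ((a + 1 : ℕ) : ℝ) + i + 1 = a + ((i + 1 : ℕ) : ℝ) + 1 := fun i => by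
        push_cast; ring
      simp only [e3, Nat.cast_zero, add_zero]
      ring
  refine ⟨h, hh, J * (P * (2 ^ N * N !)), by positivity, fun Φ C hΦ => ?_⟩
  have hC := hΦ.nonneg
  refine ⟨hΦ.contDiff_oscillatoryIntegral hh, fun k n y => (iter n k 0 C Φ hΦ y).trans ?_⟩
  have hprod : ∏ i ∈ Finset.range n, κ * (2 * h + 1 / (h * (((0 : ℕ) : ℝ) + i + 1))) ≤
      P * (4 * κ * h) ^ n := by
    have e : ∀ i : ℕ, κ * (2 * h + 1 / (h * (((0 : ℕ) : ℝ) + i + 1))) =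
        (2 * κ * h) * (1 + 1 / (2 * h ^ 2) / (i + 1)) := fun i => by
      push_cast
      rw [zero_add]
      field_simp
    rw [Finset.prod_congr rfl fun i _ => e i, Finset.prod_mul_distrib, Finset.prod_const,
      Finset.card_range]
    calc _ ≤ (2 * κ * h) ^ n * (P * 2 ^ n) := by
          gcongr
          refine le_trans (le_of_eq (Finset.prod_congr rfl fun i _ => ?_)) (hP n)
          exact (abs_of_nonneg (by positivity)).symm
      _ = P * (4 * κ * h) ^ n := by
          rw [show 4 * κ * h = 2 * κ * h * 2 by ring, mul_pow _ (2 : ℝ)]; ring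
  have hfac : ((k + N + 0 + n)! : ℝ) ≤ 2 ^ (k + n + N) * ((k + n)! * N !) := by
    rw [show k + N + 0 + n = (k + n) + N by ring]
    exact_mod_cast factorial_add_le (k + n) N
  have hRh : R * h = h₁ := mul_div_cancel₀ _ hR0.ne'
  calc |c| ^ k * (J * (C * (∏ i ∈ Finset.range n, κ * (2 * h + 1 / (h * (((0 : ℕ) : ℝ) + i + 1)))) *
          (h ^ k * (k + N + 0 + n)!)))
      ≤ |c| ^ k * (J * (C * (P * (4 * κ * h) ^ n) *
          (h ^ k * (2 ^ (k + n + N) * ((k + n)! * N !))))) := by gcongr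
    _ = J * (P * (2 ^ N * N !)) * C * ((2 * |c| * h) ^ k * (8 * κ * h) ^ n * (k + n)!) := by
        rw [show 8 * κ * h = 2 * (4 * κ * h) by ring, mul_pow 2 (4 * κ * h)]
        ring
    _ ≤ J * (P * (2 ^ N * N !)) * C * ((R * h) ^ k * (R * h) ^ n * (k + n)!) := by
        have r1 : 2 * |c| ≤ R := by rw [hR]; linarith
        have r2 : 8 * κ ≤ R := by rw [hR]; linarith [abs_nonneg c]
        gcongr
    _ = _ := by rw [hRh, add_zero, pow_add]

namespace GelfandShilov

theorem integrable_exp_mul_slice (f : GelfandShilov (X × S)) (y : Y) (x : X) :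
    Integrable fun s => Complex.exp (Complex.I * (b s y : ℝ)) * f (x, s) :=
  (f.gevreyBound one_pos).integrable_exp_mul_slice one_pos y x

/-- The oscillatory integral as a continuous operator on `S^(1)`. -/
def oscillatoryCLM [FiniteDimensional ℝ Y] (π : Y →L[ℝ] X) (b : S →L[ℝ] Y →L[ℝ] ℝ) (c : ℝ)
    (hY : ∀ y, ‖y‖ ≤ c * ‖π y‖ ∨ ∃ η : S, ‖η‖ ≤ 1 ∧ ‖y‖ ≤ c * |b η y|) :
    GelfandShilov (X × S) →L[ℂ] GelfandShilov Y :=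
  mkCLM (oscillatoryIntegral π b)
    (fun f g y => by
      unfold oscillatoryIntegral
      simp only [mul_add]
      exact integral_add (f.integrable_exp_mul_slice y (π y)) (g.integrable_exp_mul_slice y (π y)))
    (fun c f y => by
      unfold oscillatoryIntegral
      simp only [mul_left_comm _ c]
      exact integral_const_mul _ _)
    fun _ hh => exists_gevreyBound_oscillatoryIntegral hY hh

end GelfandShilov

end OscillatoryIntegral

/-! ### The Grossmann-Royer transform and convolution on test functions -/

open FourierTransform

variable {d : ℕ}

namespace GelfandShilov

theorem integrable {E : Type*} [NormedAddCommGroup E] [NormedSpace ℝ E] [MeasureSpace E]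
    [BorelSpace E] [FiniteDimensional ℝ E] [(volume : Measure E).IsAddHaarMeasure]
    (f : GelfandShilov E) : Integrable f := by
  have : ProperSpace E := FiniteDimensional.proper_real E
  exact f.toSchwartz.integrable

theorem integrable_slice {X S : Type*} [NormedAddCommGroup X] [NormedSpace ℝ X]
    [NormedAddCommGroup S] [NormedSpace ℝ S] [MeasureSpace S] [BorelSpace S]
    [FiniteDimensional ℝ S] [(volume : Measure S).IsAddHaarMeasure]
    (f : GelfandShilov (X × S)) (x : X) : Integrable fun s => f (x, s) :=
  (f.gevreyBound one_pos).integrable_slice one_pos x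

theorem exists_norm_le {E : Type*} [NormedAddCommGroup E] [NormedSpace ℝ E]
    (f : GelfandShilov E) : ∃ C : ℝ, ∀ x, ‖f x‖ ≤ C :=
  ⟨_, fun x => by simpa using (f.gevreyBound one_pos).norm_pow_mul_le 0 x⟩

/-- The linear map `(x, s) ↦ (x + s, x - s)`. -/
def sumDiff (d : ℕ) : Rd d × Rd d →L[ℝ] Rd d × Rd d :=
  ContinuousLinearMap.prod (ContinuousLinearMap.fst ℝ _ _ + ContinuousLinearMap.snd ℝ _ _)
    (ContinuousLinearMap.fst ℝ _ _ - ContinuousLinearMap.snd ℝ _ _)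

theorem norm_le_sumDiff (p : Rd d × Rd d) : ‖p‖ ≤ 1 * ‖sumDiff d p‖ := by
  have h1 : ‖p.1 + p.2‖ ≤ ‖sumDiff d p‖ := norm_fst_le (sumDiff d p)
  have h2 : ‖p.1 - p.2‖ ≤ ‖sumDiff d p‖ := norm_snd_le (sumDiff d p)
  rw [one_mul, Prod.norm_def]
  refine max_le ?_ ?_
  · have e : p.1 = (2⁻¹ : ℝ) • ((p.1 + p.2) + (p.1 - p.2)) := by module
    have := norm_add_le (p.1 + p.2) (p.1 - p.2)
    rw [e, norm_smul, Real.norm_of_nonneg (by norm_num)]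
    linarith
  · have e : p.2 = (2⁻¹ : ℝ) • ((p.1 + p.2) - (p.1 - p.2)) := by module
    have := norm_sub_le (p.1 + p.2) (p.1 - p.2)
    rw [e, norm_smul, Real.norm_of_nonneg (by norm_num)]
    linarith

/-- The bilinear form `(s, (x, ξ)) ↦ -4π s·ξ`. -/
def phaseForm (d : ℕ) : Rd d →L[ℝ] Rd d × Rd d →L[ℝ] ℝ :=
  (-4 * Real.pi) • ((ContinuousLinearMap.compL ℝ (Rd d × Rd d) (Rd d) ℝ).flip
    (ContinuousLinearMap.snd ℝ _ _) ∘L innerSL ℝ)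

theorem phaseForm_apply (s : Rd d) (z : Rd d × Rd d) :
    phaseForm d s z = -4 * Real.pi * ⟪s, z.2⟫ := by
  simp [phaseForm]
  rfl

/-- The transform `(f ⊗ h) ↦ ((x, ξ) ↦ ∫ exp(-4πi s·ξ) f(x + s) h(x - s) ds)`, which is `R_g f` for
`h = conj g`. -/
def grossmannRoyerCLM (d : ℕ) : GelfandShilov (Rd d × Rd d) →L[ℂ] GelfandShilov (Rd d × Rd d) :=
  oscillatoryCLM (ContinuousLinearMap.fst ℝ _ _) (phaseForm d) 1 (fun y => by
    rcases max_choice ‖y.1‖ ‖y.2‖ with e | e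
    · left
      rw [Prod.norm_def, e, one_mul]
      rfl
    · right
      refine ⟨‖y.2‖⁻¹ • y.2, ?_, ?_⟩
      · rw [norm_smul, norm_inv, norm_norm]
        exact inv_mul_le_one
      · rw [Prod.norm_def, e, one_mul, phaseForm_apply, real_inner_smul_left,
          real_inner_self_eq_norm_sq]
        have h1 : ‖y.2‖⁻¹ * ‖y.2‖ ^ 2 = ‖y.2‖ := by
          rcases eq_or_ne ‖y.2‖ 0 with h0 | h0
          · simp [h0]
          · field_simp
        rw [h1, abs_mul, abs_of_nonneg (norm_nonneg y.2), abs_mul, abs_of_pos Real.pi_pos]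
        refine le_mul_of_one_le_left (norm_nonneg _) ?_
        norm_num
        linarith [Real.pi_gt_three]) ∘L
  compCLM (sumDiff d) 1 norm_le_sumDiff

theorem grossmannRoyerCLM_tensor (f h : GelfandShilov (Rd d)) (z : Rd d × Rd d) :
    grossmannRoyerCLM d (tensor f h) z =
      ∫ s, Complex.exp (Complex.I * (-4 * Real.pi * ⟪s, z.2⟫ : ℝ)) * (f (z.1 + s) * h (z.1 - s)) := by
  simp only [← phaseForm_apply]
  rfl

theorem grossmannRoyerCLM_tensor_conjugate (f g : GelfandShilov (Rd d)) (z : Rd d × Rd d) :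
    grossmannRoyerCLM d (tensor f g.conjugate) z = grossmannRoyer g f z := by
  rw [grossmannRoyerCLM_tensor]
  unfold grossmannRoyer
  rw [← integral_sub_left_eq_self (fun t => Complex.exp (4 * Real.pi * Complex.I *
    (⟪z.2, t - z.1⟫ : ℝ)) * f ((2 : ℝ) • z.1 - t) * conj (g t)) volume z.1]
  refine integral_congr_ae (Filter.Eventually.of_forall fun s => ?_)
  beta_reduce
  rw [show (2 : ℝ) • z.1 - (z.1 - s) = z.1 + s by module, show z.1 - s - z.1 = -s by abel,
    inner_neg_right, real_inner_comm, conjugate_apply, mul_assoc (Complex.exp _)]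
  congr 2
  push_cast
  ring

/-- The linear map `(z, w) ↦ (w - z, w)`. -/
def shear (d : ℕ) : (Rd d × Rd d) × (Rd d × Rd d) →L[ℝ] (Rd d × Rd d) × (Rd d × Rd d) :=
  ContinuousLinearMap.prod (ContinuousLinearMap.snd ℝ _ _ - ContinuousLinearMap.fst ℝ _ _)
    (ContinuousLinearMap.snd ℝ _ _)

theorem norm_le_shear (p : (Rd d × Rd d) × (Rd d × Rd d)) : ‖p‖ ≤ 2 * ‖shear d p‖ := by
  have h1 : ‖p.2 - p.1‖ ≤ ‖shear d p‖ := norm_fst_le (shear d p)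
  have h2 : ‖p.2‖ ≤ ‖shear d p‖ := norm_snd_le (shear d p)
  rw [Prod.norm_def]
  refine max_le ?_ (by linarith [norm_nonneg p.2])
  have := norm_sub_le p.2 (p.2 - p.1)
  rw [sub_sub_cancel] at this
  linarith

/-- The operator `G ↦ ψˇ * G`. -/
def convolutionCLM (ψ : GelfandShilov (Rd d × Rd d)) :
    GelfandShilov (Rd d × Rd d) →L[ℂ] GelfandShilov (Rd d × Rd d) :=
  oscillatoryCLM (ContinuousLinearMap.id ℝ _) (0 : Rd d × Rd d →L[ℝ] Rd d × Rd d →L[ℝ] ℝ) 1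
    (fun y => Or.inl (by simp)) ∘L compCLM (shear d) 2 norm_le_shear ∘L tensor ψ

theorem convolutionCLM_apply (ψ G : GelfandShilov (Rd d × Rd d)) (z : Rd d × Rd d) :
    convolutionCLM ψ G z = ∫ w, ψ (w - z) * G w := by
  refine integral_congr_ae (Filter.Eventually.of_forall fun w => ?_)
  simp [shear]

theorem integrable_convolution (ψ G : GelfandShilov (Rd d × Rd d)) (z : Rd d × Rd d) :
    Integrable fun w => ψ (w - z) * G w :=
  (compCLM (shear d) 2 norm_le_shear (tensor ψ G)).integrable_slice z

end GelfandShilov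

/-! ### The Weyl form and Moyal's identity -/

open GelfandShilov

theorem norm_exp_two_pi_I_mul (r : ℝ) :
    ‖Complex.exp (2 * Real.pi * Complex.I * (r : ℝ))‖ = 1 := by
  rw [show 2 * Real.pi * Complex.I * (r : ℂ) = Complex.I * ((2 * Real.pi * r : ℝ) : ℂ) by
    push_cast; ring]
  exact norm_exp_I_mul_ofReal _

theorem integral_comp_two_smul (F : Rd d → ℂ) :
    ∫ s, F ((2 : ℝ) • s) = ((2 : ℂ) ^ d)⁻¹ * ∫ s, F s := by
  rw [Measure.integral_comp_smul, finrank_euclideanSpace_fin, abs_of_pos (by positivity),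
    Complex.real_smul]
  push_cast
  rfl

/-- The change of variables `(q, s) ↦ (q - s, q + s)`, of Jacobian `2 ^ d`. -/
theorem integral_integral_sub_add {G : Rd d × Rd d → ℂ} (hG : Integrable G) :
    ∫ q, ∫ s, G (q - s, q + s) = ((2 : ℂ) ^ d)⁻¹ * ∫ x, ∫ y, G (x, y) := by
  set L : (Rd d × Rd d) ≃ₗ[ℝ] (Rd d × Rd d) :=
    { toFun := fun p => (p.1 - p.2, p.1 + p.2)
      map_add' := fun p q => by
        ext1 <;> simp only [Prod.fst_add, Prod.snd_add] <;> abel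
      map_smul' := fun c p => by ext1 <;> simp [smul_add, smul_sub]
      invFun := fun p => ((2⁻¹ : ℝ) • (p.1 + p.2), (2⁻¹ : ℝ) • (p.2 - p.1))
      left_inv := fun p => by ext1 <;> simp only <;> module
      right_inv := fun p => by ext1 <;> simp only <;> module } with hL
  have hdet : LinearMap.det (L : (Rd d × Rd d) →ₗ[ℝ] (Rd d × Rd d)) ≠ 0 :=
    (LinearEquiv.isUnit_det' L).ne_zero
  have hint : Integrable fun p : Rd d × Rd d => G (p.1 - p.2, p.1 + p.2) := by
    have h1 : Integrable G (Measure.map (L : (Rd d × Rd d) →ₗ[ℝ] (Rd d × Rd d)) volume) := by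
      rw [Measure.map_linearMap_addHaar_eq_smul_addHaar volume hdet]
      exact hG.smul_measure ENNReal.ofReal_ne_top
    exact h1.comp_measurable (L.toContinuousLinearEquiv.continuous.measurable)
  rw [integral_integral_swap hint]
  have e1 : ∀ s : Rd d, ∫ q, G (q - s, q + s) = ∫ u, G (u, u + (2 : ℝ) • s) := fun s => by
    rw [← integral_add_right_eq_self _ s]
    refine integral_congr_ae (Filter.Eventually.of_forall fun u => ?_)
    beta_reduce
    rw [add_sub_cancel_right, add_assoc, ← two_smul ℝ s]
  have e2 : ∫ s : Rd d, ∫ q, G (q - s, q + s) = ((2 : ℂ) ^ d)⁻¹ * ∫ s, ∫ u, G (u, u + s) := by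
    simp only [e1]
    exact integral_comp_two_smul fun s => ∫ u, G (u, u + s)
  have hint2 : Integrable fun p : Rd d × Rd d => G (p.2, p.2 + p.1) := by
    exact ((measurePreserving_prod_add_swap (volume : Measure (Rd d))
      (volume : Measure (Rd d))).integrable_comp hG.1).2 hG
  rw [e2, integral_integral_swap hint2]
  congr 1
  refine integral_congr_ae (Filter.Eventually.of_forall fun u => ?_)
  exact integral_add_left_eq_self (fun v => G (u, v)) u

/-- The functional `τ ↦ ⟨L_τ f, g⟩` on test symbols is represented by `2^d R_g f`. -/
theorem representsWeylForm_grossmannRoyer (f g : GelfandShilov (Rd d)) :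
    RepresentsWeylForm f g ((2 : ℂ) ^ d • grossmannRoyerCLM d (tensor f g.conjugate)) := by
  intro τ
  set h := g.conjugate with hh
  -- the integrand of the threefold integral, with the variables in the order `x`, `y`, `ξ`
  set H : Rd d → Rd d → Rd d → ℂ := fun x y ξ =>
    Complex.exp (2 * Real.pi * Complex.I * (⟪x - y, ξ⟫ : ℝ)) *
      (τ ((2⁻¹ : ℝ) • (x + y), ξ) * (f y * h x)) with hH
  have hτ := τ.contDiff.continuous
  have hint3 : Integrable fun p : Rd d × (Rd d × Rd d) => H p.1 p.2.1 p.2.2 := by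
    set M : Rd d × (Rd d × Rd d) →L[ℝ] (Rd d × Rd d) × (Rd d × Rd d) :=
      ContinuousLinearMap.prod
        (ContinuousLinearMap.prod
          ((2⁻¹ : ℝ) • (ContinuousLinearMap.fst ℝ (Rd d) (Rd d × Rd d) +
            ContinuousLinearMap.fst ℝ (Rd d) (Rd d) ∘L ContinuousLinearMap.snd ℝ _ _))
          (ContinuousLinearMap.snd ℝ (Rd d) (Rd d) ∘L ContinuousLinearMap.snd ℝ _ _))
        (ContinuousLinearMap.prod
          (ContinuousLinearMap.fst ℝ (Rd d) (Rd d) ∘L ContinuousLinearMap.snd ℝ _ _)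
          (ContinuousLinearMap.fst ℝ (Rd d) (Rd d × Rd d))) with hM
    have hK : ∀ p, ‖p‖ ≤ 1 * ‖M p‖ := fun p => by
      rw [one_mul]
      have h1 : ‖p.2.2‖ ≤ ‖M p‖ := (norm_snd_le (M p).1).trans (norm_fst_le (M p))
      have h2 : ‖p.2.1‖ ≤ ‖M p‖ := (norm_fst_le (M p).2).trans (norm_snd_le (M p))
      have h3 : ‖p.1‖ ≤ ‖M p‖ := (norm_snd_le (M p).2).trans (norm_snd_le (M p))
      exact max_le h3 (max_le h2 h1)
    have : (volume : Measure (Rd d × (Rd d × Rd d))).IsAddHaarMeasure :=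
      Measure.prod.instIsAddHaarMeasure (volume : Measure (Rd d)) (volume : Measure (Rd d × Rd d))
    have hQ := (compCLM M 1 hK (tensor τ (tensor f h))).integrable
    have hcont : Continuous fun p : Rd d × (Rd d × Rd d) =>
        Complex.exp (2 * Real.pi * Complex.I * (⟪p.1 - p.2.1, p.2.2⟫ : ℝ)) := by fun_prop
    exact hQ.bdd_mul (c := 1) hcont.aestronglyMeasurable
      (Filter.Eventually.of_forall fun p => (norm_exp_two_pi_I_mul _).le)
  have hint2 : ∀ ξ, Integrable fun p : Rd d × Rd d => H p.1 p.2 ξ := fun ξ => by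
    obtain ⟨C, hC⟩ := τ.exists_norm_le
    have e : (fun p : Rd d × Rd d => H p.1 p.2 ξ) = fun p =>
        (Complex.exp (2 * Real.pi * Complex.I * (⟪p.1 - p.2, ξ⟫ : ℝ)) *
          τ ((2⁻¹ : ℝ) • (p.1 + p.2), ξ)) * (tensor h f) p := by
      funext p
      simp only [hH, tensor_apply]
      ring
    rw [e]
    refine (tensor h f).integrable.bdd_mul (c := C)
      (Continuous.aestronglyMeasurable (by fun_prop)) (Filter.Eventually.of_forall fun p => ?_)
    rw [norm_mul, norm_exp_two_pi_I_mul, one_mul]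
    exact hC _
  have inner : ∀ ξ, ∫ y, ∫ x, H x y ξ =
      ∫ q, τ (q, ξ) * ((2 : ℂ) ^ d • grossmannRoyerCLM d (tensor f h)) (q, ξ) := fun ξ => by
    have e := integral_integral_sub_add (hint2 ξ)
    rw [eq_inv_mul_iff_mul_eq₀ (pow_ne_zero _ two_ne_zero)] at e
    rw [← integral_integral_swap (f := fun x y => H x y ξ) (hint2 ξ), ← e, ← integral_const_mul]
    refine integral_congr_ae (Filter.Eventually.of_forall fun q => ?_)
    beta_reduce
    rw [GelfandShilov.smul_apply, grossmannRoyerCLM_tensor, mul_left_comm,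
      ← integral_const_mul (τ (q, ξ))]
    congr 1
    refine integral_congr_ae (Filter.Eventually.of_forall fun s => ?_)
    simp only [hH]
    rw [show (2⁻¹ : ℝ) • (q - s + (q + s)) = q by module, show q - s - (q + s) = (-2 : ℝ) • s by
      module, real_inner_smul_left, mul_left_comm]
    congr 3
    push_cast
    ring
  calc ∫ x, weylTestOperator τ f x * conj (g x)
      = ∫ x, ∫ p : Rd d × Rd d, H x p.1 p.2 := by
        refine integral_congr_ae (Filter.Eventually.of_forall fun x => ?_)
        beta_reduce
        unfold weylTestOperator
        rw [← integral_mul_const]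
        refine integral_congr_ae (Filter.Eventually.of_forall fun p => ?_)
        simp only [hH, hh, conjugate_apply]
        ring
    _ = ∫ p : Rd d × Rd d, ∫ x, H x p.1 p.2 := integral_integral_swap hint3
    _ = ∫ y, ∫ ξ, ∫ x, H x y ξ := integral_prod _ hint3.integral_prod_right
    _ = ∫ ξ, ∫ y, ∫ x, H x y ξ := integral_integral_swap hint3.integral_prod_right
    _ = ∫ ξ, ∫ q, τ (q, ξ) * ((2 : ℂ) ^ d • grossmannRoyerCLM d (tensor f h)) (q, ξ) := by
        simp only [inner]
    _ = _ := (integral_prod_symm _ (τ.integrable_mul _)).symm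

/-- Parseval's formula, in its bilinear form and with frequencies scaled by two. -/
theorem integral_fourier_two_smul_mul {a b : Rd d → ℂ} (ha : Integrable a) (hb : Integrable b)
    (hbc : Continuous b) (hFb : Integrable fun w => 𝓕 b ((2 : ℝ) • w)) :
    ∫ w, 𝓕 a ((2 : ℝ) • w) * 𝓕 b ((2 : ℝ) • w) = ((2 : ℂ) ^ d)⁻¹ * ∫ s, a s * b (-s) := by
  rw [integral_comp_two_smul fun w => 𝓕 a w * 𝓕 b w]
  congr 1
  have hFb' : Integrable (𝓕 b) := (integrable_comp_smul_iff volume (𝓕 b) two_ne_zero).1 hFb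
  have e : ∀ s, 𝓕 (𝓕 b) s = b (-s) := fun s => by
    rw [← congrFun (hbc.fourierInv_fourier_eq hb hFb') (-s), Real.fourierInv_eq_fourier_neg, neg_neg]
  have h1 : ∫ w, 𝓕 a w * 𝓕 b w = ∫ s, a s * 𝓕 (𝓕 b) s := by
    simpa using! VectorFourier.integral_fourierIntegral_smul_eq_flip (L := innerₗ (Rd d))
      Real.continuous_fourierChar continuous_inner ha hFb'
  simp only [h1, e]

theorem grossmannRoyerCLM_tensor_eq_fourier (f h : GelfandShilov (Rd d)) (x ξ : Rd d) :
    grossmannRoyerCLM d (tensor f h) (x, ξ) =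
      𝓕 (fun s => f (x + s) * h (x - s)) ((2 : ℝ) • ξ) := by
  rw [grossmannRoyerCLM_tensor, Real.fourier_eq']
  refine integral_congr_ae (Filter.Eventually.of_forall fun s => ?_)
  beta_reduce
  rw [smul_eq_mul, real_inner_smul_right]
  congr 2
  push_cast
  ring

/-- Moyal's identity: the correlation of two transforms is a product of two short-time Fourier
transforms. -/
theorem convolutionCLM_grossmannRoyerCLM (f h ψ k : GelfandShilov (Rd d)) (x ξ : Rd d) :
    convolutionCLM (grossmannRoyerCLM d (tensor ψ k)) (grossmannRoyerCLM d (tensor f h)) (x, ξ) =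
      ((2 : ℂ) ^ d)⁻¹ * (((2 : ℂ) ^ d)⁻¹ *
        ((∫ u, Complex.exp (-2 * Real.pi * Complex.I * (⟪u, ξ⟫ : ℝ)) * f u * k (u - x)) *
          ∫ v, Complex.exp (2 * Real.pi * Complex.I * (⟪v, ξ⟫ : ℝ)) * h v * ψ (v - x))) := by
  have hfc := f.contDiff.continuous
  have hhc := h.contDiff.continuous
  have hψc := ψ.contDiff.continuous
  have hkc := k.contDiff.continuous
  have slice : ∀ (p q : GelfandShilov (Rd d)) (y : Rd d),
      Integrable fun s => p (y + s) * q (y - s) := fun p q y =>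
    (compCLM (sumDiff d) 1 norm_le_sumDiff (tensor p q)).integrable_slice y
  set G : Rd d × Rd d → ℂ := fun p =>
    (Complex.exp (-2 * Real.pi * Complex.I * (⟪p.1, ξ⟫ : ℝ)) * f p.1 * k (p.1 - x)) *
      (Complex.exp (2 * Real.pi * Complex.I * (⟪p.2, ξ⟫ : ℝ)) * h p.2 * ψ (p.2 - x)) with hG
  have hGint : Integrable G := by
    have hi : ∀ (p q : GelfandShilov (Rd d)) (e : Rd d → ℂ), Continuous e → (∀ u, ‖e u‖ = 1) →
        Integrable fun u => e u * p u * q (u - x) := fun p q e he hn => by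
      have hq := q.contDiff.continuous
      have hp := p.contDiff.continuous
      obtain ⟨C, hC⟩ := q.exists_norm_le
      have e1 : (fun u => e u * p u * q (u - x)) = fun u => (e u * q (u - x)) * p u := by
        funext u
        ring
      rw [e1]
      refine p.integrable.bdd_mul (c := C) (Continuous.aestronglyMeasurable (by fun_prop))
        (Filter.Eventually.of_forall fun u => ?_)
      rw [norm_mul, hn, one_mul]
      exact hC _
    have h1 := hi f k (fun u => Complex.exp (-2 * Real.pi * Complex.I * (⟪u, ξ⟫ : ℝ)))
      (by fun_prop) fun u => by
        rw [← norm_exp_two_pi_I_mul (-⟪u, ξ⟫)]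
        congr 2
        push_cast
        ring
    have h2 := hi h ψ (fun v => Complex.exp (2 * Real.pi * Complex.I * (⟪v, ξ⟫ : ℝ)))
      (by fun_prop) fun u => norm_exp_two_pi_I_mul _
    exact h1.mul_prod h2
  have inner : ∀ y : Rd d,
      ∫ w, grossmannRoyerCLM d (tensor ψ k) (y - x, w - ξ) *
        grossmannRoyerCLM d (tensor f h) (y, w) =
      ((2 : ℂ) ^ d)⁻¹ * ∫ s, G (y - s, y + s) := fun y => by
    set a : Rd d → ℂ := fun s => Complex.exp (2 * Real.pi * Complex.I * (⟪(2 : ℝ) • s, ξ⟫ : ℝ)) *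
      (ψ (y - x + s) * k (y - x - s)) with ha
    have hphase : Continuous fun s : Rd d =>
        Complex.exp (2 * Real.pi * Complex.I * (⟪(2 : ℝ) • s, ξ⟫ : ℝ)) := by fun_prop
    have haint : Integrable a := (slice ψ k (y - x)).bdd_mul (c := 1)
      hphase.aestronglyMeasurable (Filter.Eventually.of_forall fun u => (norm_exp_two_pi_I_mul _).le)
    -- the translation by `ξ` on the Fourier side is absorbed into the phase of `a`
    have hFa : ∀ w, grossmannRoyerCLM d (tensor ψ k) (y - x, w - ξ) = 𝓕 a ((2 : ℝ) • w) := fun w => by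
      rw [grossmannRoyerCLM_tensor, Real.fourier_eq']
      refine integral_congr_ae (Filter.Eventually.of_forall fun s => ?_)
      simp only [ha]
      rw [smul_eq_mul, ← mul_assoc (Complex.exp _) (Complex.exp _), ← Complex.exp_add,
        inner_sub_right, real_inner_smul_right,
        real_inner_smul_left]
      congr 2
      push_cast
      ring
    simp only [hFa, grossmannRoyerCLM_tensor_eq_fourier]
    rw [integral_fourier_two_smul_mul haint (slice f h y) (by fun_prop)]
    · congr 1
      refine integral_congr_ae (Filter.Eventually.of_forall fun s => ?_)
      simp only [ha, hG]
      rw [show y - x + s = y + s - x by abel, show y - x - s = y - s - x by abel, sub_neg_eq_add,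
        ← sub_eq_add_neg, show (2 : ℝ) • s = (y + s) - (y - s) by module, inner_sub_left,
        show 2 * Real.pi * Complex.I * ((⟪y + s, ξ⟫ - ⟪y - s, ξ⟫ : ℝ) : ℂ) =
          -2 * Real.pi * Complex.I * (⟪y - s, ξ⟫ : ℝ) +
          2 * Real.pi * Complex.I * (⟪y + s, ξ⟫ : ℝ) by push_cast; ring, Complex.exp_add]
      ring
    · simp only [← grossmannRoyerCLM_tensor_eq_fourier]
      exact (grossmannRoyerCLM d (tensor f h)).integrable_slice y
  rw [convolutionCLM_apply]
  have hprod := integral_prod (μ := (volume : Measure (Rd d))) (ν := (volume : Measure (Rd d))) _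
    (integrable_convolution (grossmannRoyerCLM d (tensor ψ k))
      (grossmannRoyerCLM d (tensor f h)) (x, ξ))
  refine hprod.trans ?_
  simp only [Prod.mk_sub_mk, inner]
  rw [integral_const_mul, integral_integral_sub_add hGint]
  congr 2
  simp only [hG, integral_const_mul, integral_mul_const]

/-- `R_{ψˇ} f(·/2)` is a short-time Fourier transform up to a phase. -/
theorem grossmannRoyer_reflection_half (ψ f : Rd d → ℂ) (x ξ : Rd d) :
    grossmannRoyer (fun t => ψ (-t)) f ((2⁻¹ : ℝ) • (x, ξ)) =
      Complex.exp (Real.pi * Complex.I * (⟪x, ξ⟫ : ℝ)) *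
        ∫ u, Complex.exp (-2 * Real.pi * Complex.I * (⟪u, ξ⟫ : ℝ)) * f u * conj (ψ (u - x)) := by
  unfold grossmannRoyer
  rw [← integral_sub_left_eq_self (fun t : Rd d => Complex.exp (4 * Real.pi * Complex.I *
    (⟪((2⁻¹ : ℝ) • (x, ξ)).2, t - ((2⁻¹ : ℝ) • (x, ξ)).1⟫ : ℝ)) *
    f ((2 : ℝ) • ((2⁻¹ : ℝ) • (x, ξ)).1 - t) * conj (ψ (-t))) volume x, ← integral_const_mul]
  refine integral_congr_ae (Filter.Eventually.of_forall fun u => ?_)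
  simp only [Prod.smul_mk]
  rw [show (2 : ℝ) • (2⁻¹ : ℝ) • x - (x - u) = u by module, neg_sub,
    mul_assoc (Complex.exp _) (f u), mul_assoc (Complex.exp _) (f u),
    ← mul_assoc (Complex.exp _) (Complex.exp _), ← Complex.exp_add,
    show x - u - (2⁻¹ : ℝ) • x = (2⁻¹ : ℝ) • x - u by module, inner_sub_right,
    real_inner_smul_left, real_inner_smul_left, real_inner_smul_right, real_inner_comm x ξ,
    real_inner_comm u ξ]
  congr 2
  push_cast
  ring

theorem localization_symbol_eq (φ₁ φ₂ f g : GelfandShilov (Rd d)) (z : Rd d × Rd d) :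
    grossmannRoyer (fun t => φ₁ (-t)) f ((2⁻¹ : ℝ) • z) *
      conj (grossmannRoyer (fun t => φ₂ (-t)) g ((2⁻¹ : ℝ) • z)) =
    (2 : ℂ) ^ d * ((2 : ℂ) ^ d * convolutionCLM (grossmannRoyerCLM d (tensor φ₂ φ₁.conjugate))
      (grossmannRoyerCLM d (tensor f g.conjugate)) z) := by
  obtain ⟨x, ξ⟩ := z
  rw [convolutionCLM_grossmannRoyerCLM, grossmannRoyer_reflection_half,
    grossmannRoyer_reflection_half, map_mul, ← integral_conj, ← Complex.exp_conj,
    mul_mul_mul_comm, ← Complex.exp_add]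
  have h0 : (2 : ℂ) ^ d ≠ 0 := pow_ne_zero _ two_ne_zero
  rw [mul_inv_cancel_left₀ h0, mul_inv_cancel_left₀ h0]
  have e1 : Real.pi * Complex.I * ((⟪x, ξ⟫ : ℝ) : ℂ) +
      conj (Real.pi * Complex.I * ((⟪x, ξ⟫ : ℝ) : ℂ)) = 0 := by
    simp
  rw [e1, Complex.exp_zero, one_mul]
  congr 1
  refine integral_congr_ae (Filter.Eventually.of_forall fun v => ?_)
  simp [← Complex.exp_conj, map_ofNat (starRingEnd ℂ) 2]

end

/-- For `a` in `S^(1)'(ℝ^{2d})` and `φ₁, φ₂` in `S^(1)(ℝ^d)`: the transform `ρ = R_{φ₁} φ₂` is a test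
function, the convolution `σ = a * ρ`, the localization operator `A = A_a^{φ₁, φ₂}` and the Weyl
operator `L = L_σ` exist (each is unique), `A` is the Weyl operator with symbol `2^d σ`,
and `A = 2^d L`. -/
theorem lemma4p3 (d : ℕ) (a : Ultradistribution (Rd d × Rd d)) (φ₁ φ₂ : GelfandShilov (Rd d)) :
    ∃ (ρ : GelfandShilov (Rd d × Rd d)) (σ : Ultradistribution (Rd d × Rd d))
      (A L : GelfandShilov (Rd d) →L[ℂ] Ultradistribution (Rd d)),
      (∀ z, ρ z = grossmannRoyer φ₁ φ₂ z) ∧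
      IsConvolution a ρ σ ∧
      IsLocalizationOperator a φ₁ φ₂ A ∧
      IsWeylOperator σ L ∧
      IsWeylOperator ((2 : ℂ) ^ d • σ) A ∧
      A = (2 : ℂ) ^ d • L := by
  set ρ := GelfandShilov.grossmannRoyerCLM d (GelfandShilov.tensor φ₂ φ₁.conjugate)
  set σ : Ultradistribution (Rd d × Rd d) := a ∘L GelfandShilov.convolutionCLM ρ
  set L := GelfandShilov.kernelOperator
    (σ ∘L ((2 : ℂ) ^ d • GelfandShilov.grossmannRoyerCLM d))
  refine ⟨ρ, σ, (2 : ℂ) ^ d • L, L, GelfandShilov.grossmannRoyerCLM_tensor_conjugate φ₂ φ₁,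
    fun G => ⟨GelfandShilov.convolutionCLM ρ G, GelfandShilov.convolutionCLM_apply ρ G, rfl⟩,
    fun f g => ?_,
    fun f g => ⟨_, representsWeylForm_grossmannRoyer f g, rfl⟩,
    fun f g => ⟨_, representsWeylForm_grossmannRoyer f g, rfl⟩, rfl⟩
  set S := GelfandShilov.grossmannRoyerCLM d (GelfandShilov.tensor f g.conjugate)
  refine ⟨(2 : ℂ) ^ d • (2 : ℂ) ^ d • GelfandShilov.convolutionCLM ρ S,
    fun z => (localization_symbol_eq φ₁ φ₂ f g z).symm, ?_⟩
  change (2 : ℂ) ^ d • a (GelfandShilov.convolutionCLM ρ ((2 : ℂ) ^ d • S)) = _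
  rw [map_smul, map_smul, map_smul, map_smul]
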